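/- **Setting.** For each $n$, let $G_n$ be a simple undirected graph on $[n]=\{1,\dots,n\}$ with neighbour sets $\mathcal N_i$ and degrees $D_i=|\mathcal N_i|$, where $D_i\ge 1$ for all $i$ once $n$ is large. Let $\mathcal N(i;d)$ be the set of units at graph distance at most $d$ from $i$ (including $i$). Let $E_1,\dots,E_{K_n}$ be a partition of $[n]$ into ego-clusters (each consists of a unit, the ego, and some of its neighbours), and let $e(i)$ be the index of the cluster of $i$. Graph and clusters are given (non-random). The cluster treatments $T^{\mathcal E}_1,\dots,T^{\mathcal E}_{K_n}$ are i.i.d. Bernoulli$(1/2)$, $T_i=T^{\mathcal E}_{e(i)}$, $\rho_i=D_i^{-1}\sum_{j\in\mathcal N_i}T_j$, and $$Y_i=\alpha+\beta T_i+\gamma\rho_i+\epsilon_i,$$ with constants $\alpha,\beta,\gamma\in\mathbb R$ not depending on $n$. Let $X=[1_n;T;\rho]$, $(\hat\alpha,\hat\beta,\hat\gamma)^{\mathrm T}=(X^{\mathrm T}X)^{-1}X^{\mathrm T}Y$, $\tau=\beta+\gamma$ and $\hat\tau=\hat\beta+\hat\gamma$ (with any fixed convention when $X^{\mathrm T}X$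 is singular). Put $R_{ik}=|\mathcal N_i\cap E_k|/D_i$, $r_i=1-R_{ie(i)}$, $\bar r_n=n^{-1}\sum_i r_i$, and $$b_n=\frac1n\sum_{i}\sum_{k\ne e(i)}R_{ik}^2+\frac1n\sum_i(r_i-\bar r_n)^2 .$$ Let $\Lambda_{ij}=1$ if some cluster meets both $\mathcal N(i;1)$ and $\mathcal N(j;1)$, and $\Lambda_{ij}=0$ otherwise; let $N_i=\{j:\Lambda_{ij}=1\}$. Let $\nu_i^2=\mathrm{Var}(\epsilon_i)$ and $\nu_{ij}=\mathrm{Cov}(\epsilon_i,\epsilon_j)$. Define $$W'_i=\frac{4}{b_n}\Big\{\big(\rho_i-\tfrac12\big)-(1-\bar r_n)\big(T_i-\tfrac12\big)\Big\},\qquad W_i=4\big(T_i-\tfrac12\big)+\bar r_n W'_i,$$ $$\sigma_{\tau,n}^2=\frac1n\sum_i \mathrm E(W_i^2)\nu_i^2+\frac1n\sum_i\sum_{j\in\mathcal N(i;2)\setminus\{i\}}\mathrm E(W_iW_j)\nu_{ij},$$ and define $\sigma_{\gamma,n}^2$ by the same formula with $W'$ in place of $W$. **Assumptions** (as $n\to\infty$).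 1. $\max_k|E_k|=o(n)$. 2. There is $c_0>0$ with $\max\big\{n^{-1}\sum_i\sum_{k\ne e(i)}R_{ik}^2,\ n^{-1}\sum_i(r_i-\bar r_n)^2\big\}>c_0$ for all large $n$. 3. $n^{-1}\sum_i|N_i|^2=o(\sqrt n)$, $n^{-1}\sum_i|N_i|^3=o(n)$, $n^{-1}\sum_{i,j}(\Lambda^3)_{ij}=o(n)$. 4. (a) For each $n$ and all $I,J\subseteq[n]$ such that every $i\in I$ and $j\in J$ are at graph distance more than two, $(\epsilon_i)_{i\in I}$ and $(\epsilon_j)_{j\in J}$ are independent. (b) $\epsilon$ is independent of $T$, $\mathrm E(\epsilon)=0$, and $\sup_n\max_{i\le n}\nu_i^2<\infty$. (c) $n^{-1}\sum_i\sum_{j\in\mathcal N(i;2)\setminus\{i\}}\nu_{ij}=O(1)$. 5. $\sup_n\max_{i\le n}\mathrm E(\epsilon_i^4)<\infty$. **Theorem.** Under these assumptions, if $\liminf_n\sigma_{\tau,n}^2>0$, then $\sigma_{\tau,n}^{-1}\sqrt n(\hat\tau-\tau)\xrightarrow{d}\mathcal N(0,1)$; and if $\liminf_n\sigma_{\gamma,n}^2>0$,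 then $\sigma_{\gamma,n}^{-1}\sqrt n(\hat\gamma-\gamma)\xrightarrow{d}\mathcal N(0,1)$. -/

import Mathlib

open MeasureTheory ProbabilityTheory Filter Asymptotics

/-- A network on the units `Fin n` together with a partition of the units into ego-clusters:
`e i` is the index of the cluster of unit `i`, `ego k` is the focal unit of cluster `k`, and every
other member of a cluster (an alter) is a network neighbour of its ego. -/
structure EgoDesign (n : ℕ) where
  /-- the observed network -/
  graph : SimpleGraph (Fin n)
  /-- the number of ego-clusters -/
  K : ℕ
  /-- cluster membership -/
  e : Fin n → Fin K
  /-- the ego of each cluster -/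
  ego : Fin K → Fin n
  e_ego : ∀ k, e (ego k) = k
  adj_ego : ∀ i, i ≠ ego (e i) → graph.Adj (ego (e i)) i

noncomputable section

namespace EgoDesign

variable {n : ℕ} (D : EgoDesign n)

open Classical in
/-- The set of neighbours `𝒩_i` of unit `i`. -/
def nbrs (i : Fin n) : Finset (Fin n) := {j | D.graph.Adj i j}

/-- The degree `D_i`. -/
def deg (i : Fin n) : ℕ := (D.nbrs i).card

open Classical in
/-- `𝒩(i; d)`: the units at shortest-path distance at most `d` from `i`
(including `i`; unreachable units are at distance `⊤`). -/
def ball (i : Fin n) (d : ℕ) : Finset (Fin n) := {j | D.graph.edist i j ≤ d}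

/-- The ego-cluster `E_k`. -/
def cluster (k : Fin D.K) : Finset (Fin n) := {i | D.e i = k}

/-- `max_k |E_k|`. -/
def maxClusterSize : ℕ := Finset.univ.sup fun k => (D.cluster k).card

/-- The interference matrix `R_{ik} = |𝒩_i ∩ E_k| / D_i`. -/
def R (i : Fin n) (k : Fin D.K) : ℝ := ((D.nbrs i ∩ D.cluster k).card : ℝ) / D.deg i

/-- The loss rate `r_i = 1 - R_{i e(i)}`. -/
def lossRate (i : Fin n) : ℝ := 1 - D.R i (D.e i)

/-- The average loss rate `r̄_n`. -/
def meanLoss : ℝ := (∑ i, D.lossRate i) / n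

/-- `n⁻¹ ∑_i ∑_{k ≠ e(i)} R_{ik}²`. -/
def crossTerm : ℝ := (∑ i, ∑ k ∈ Finset.univ.erase (D.e i), D.R i k ^ 2) / n

/-- `n⁻¹ ∑_i (r_i - r̄_n)²`. -/
def lossVar : ℝ := (∑ i, (D.lossRate i - D.meanLoss) ^ 2) / n

/-- `b_n`. -/
def b : ℝ := D.crossTerm + D.lossVar

open Classical in
/-- `𝒦_i`: the clusters met by `𝒩(i; 1)`. -/
def reach (i : Fin n) : Finset (Fin D.K) := {k | (D.ball i 1 ∩ D.cluster k).Nonempty}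

open Classical in
/-- The adjacency matrix `Λ` of the dependency graph. -/
def Lam : Matrix (Fin n) (Fin n) ℝ :=
  Matrix.of fun i j => if (D.reach i ∩ D.reach j).Nonempty then 1 else 0

open Classical in
/-- The dependence set `N_i = {j | Λ_{ij} = 1}`. -/
def depSet (i : Fin n) : Finset (Fin n) := {j | D.Lam i j = 1}

/-- The unit-level treatment vector `T_i = T^ℰ_{e(i)}` induced by the cluster assignments
(`true` is treatment, `false` is control). -/
def treat (t : Fin D.K → Bool) (i : Fin n) : ℝ := if t (D.e i) then 1 else 0

/-- The fraction of treated neighbours `ρ_i = ∑_j A_{ij} T_j / D_i`. -/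
def rho (T : Fin n → ℝ) (i : Fin n) : ℝ := (∑ j ∈ D.nbrs i, T j) / D.deg i

/-- The outcome model `Y_i = α + β T_i + γ ρ_i + ε_i`. -/
def outcome (α β γ : ℝ) (T ε : Fin n → ℝ) (i : Fin n) : ℝ :=
  α + β * T i + γ * D.rho T i + ε i

/-- The design matrix `X = [1; T; ρ]`. -/
def designMatrix (T : Fin n → ℝ) : Matrix (Fin n) (Fin 3) ℝ :=
  Matrix.of fun i => ![1, T i, D.rho T i]

/-- The least squares estimator `(α̂, β̂, γ̂) = (XᵀX)⁻¹ Xᵀ Y`. -/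
def ols (T Y : Fin n → ℝ) : Fin 3 → ℝ :=
  (((D.designMatrix T).transpose * D.designMatrix T)⁻¹ * (D.designMatrix T).transpose).mulVec Y

/-- `τ̂ = β̂ + γ̂`. -/
def tauHat (T Y : Fin n → ℝ) : ℝ := D.ols T Y 1 + D.ols T Y 2

/-- `γ̂`. -/
def gammaHat (T Y : Fin n → ℝ) : ℝ := D.ols T Y 2

/-- The weight of `ε_i` in the leading term of `√n (γ̂ - γ)`, that is
`W'_i = (0, 0, 1) (E XᵀX / n)⁻¹ (1, T_i, ρ_i)ᵀ`, written out. -/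
def Wgamma (T : Fin n → ℝ) (i : Fin n) : ℝ :=
  4 / D.b * ((D.rho T i - 1 / 2) - (1 - D.meanLoss) * (T i - 1 / 2))

/-- The weight of `ε_i` in the leading term of `√n (τ̂ - τ)`, that is
`W_i = (0, 1, 1) (E XᵀX / n)⁻¹ (1, T_i, ρ_i)ᵀ`, written out. -/
def Wtau (T : Fin n → ℝ) (i : Fin n) : ℝ :=
  4 * (T i - 1 / 2) + D.meanLoss * D.Wgamma T i

/-- `n⁻¹ ∑_i ∑_{j ∈ 𝒩(i;2) \ {i}} ν_{ij}` with `ν_{ij} = Cov(ε_i, ε_j)`. -/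
def covSum {Ω : Type*} [MeasurableSpace Ω] (P : Measure Ω) (ε : Fin n → Ω → ℝ) : ℝ :=
  (∑ i, ∑ j ∈ (D.ball i 2).erase i, covariance (ε i) (ε j) P) / n

/-- `n⁻¹ ∑_i E(W_i²) ν_i² + n⁻¹ ∑_i ∑_{j ∈ 𝒩(i;2) \ {i}} E(W_i W_j) ν_{ij}`
for weights `W_i = W T i` that are functions of the treatment vector. -/
def asympVar {Ω : Type*} [MeasurableSpace Ω] (P : Measure Ω) (t : Fin D.K → Ω → Bool)
    (ε : Fin n → Ω → ℝ) (W : (Fin n → ℝ) → Fin n → ℝ) : ℝ :=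
  (∑ i, (∫ ω, W (D.treat fun k => t k ω) i ^ 2 ∂P) * variance (ε i) P) / n
  + (∑ i, ∑ j ∈ (D.ball i 2).erase i,
      (∫ ω, W (D.treat fun k => t k ω) i * W (D.treat fun k => t k ω) j ∂P)
        * covariance (ε i) (ε j) P) / n

/-- `σ²_{τ,n}`. -/
def sigmaTauSq {Ω : Type*} [MeasurableSpace Ω] (P : Measure Ω) (t : Fin D.K → Ω → Bool)
    (ε : Fin n → Ω → ℝ) : ℝ := D.asympVar P t ε D.Wtau

/-- `σ²_{γ,n}`. -/
def sigmaGammaSq {Ω : Type*} [MeasurableSpace Ω] (P : Measure Ω) (t : Fin D.K → Ω → Bool)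
    (ε : Fin n → Ω → ℝ) : ℝ := D.asympVar P t ε D.Wgamma

end EgoDesign

/-- Ego-cluster randomization: `max_k |E_k| = o(n)`, and the cluster treatments are
i.i.d. Bernoulli(1/2). -/
structure EgoRandomization (D : (n : ℕ) → EgoDesign n) {Ω : ℕ → Type*}
    [∀ n, MeasurableSpace (Ω n)] (P : (n : ℕ) → Measure (Ω n))
    (t : (n : ℕ) → Fin (D n).K → Ω n → Bool) : Prop where
  cluster_size : (fun n => ((D n).maxClusterSize : ℝ)) =o[atTop] (fun n : ℕ => (n : ℝ))
  measurable : ∀ n k, Measurable (t n k)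
  indep : ∀ n, iIndepFun (t n) (P n)
  bernoulli : ∀ n k, P n {ω | t n k ω = true} = 1 / 2

/-- Non-vanishing variation of the interference. -/
def NetworkVariation (D : (n : ℕ) → EgoDesign n) : Prop :=
  ∃ c₀ : ℝ, 0 < c₀ ∧ ∀ᶠ n in atTop, c₀ < max (D n).crossTerm (D n).lossVar

/-- Growth conditions on the dependency graph. -/
structure DependencyGrowth (D : (n : ℕ) → EgoDesign n) : Prop where
  second : (fun n : ℕ => (∑ i, (((D n).depSet i).card : ℝ) ^ 2) / n)
    =o[atTop] (fun n : ℕ => Real.sqrt n)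
  third : (fun n : ℕ => (∑ i, (((D n).depSet i).card : ℝ) ^ 3) / n)
    =o[atTop] (fun n : ℕ => (n : ℝ))
  paths : (fun n : ℕ => (∑ i, ∑ j, ((D n).Lam ^ 3) i j) / n)
    =o[atTop] (fun n : ℕ => (n : ℝ))

/-- Errors correlated within graph distance two: (a) sets of errors whose units are pairwise at
distance more than two are independent; (b) the errors are independent of the treatments, centred,
and have uniformly bounded variances; (c) the averaged covariance sum is `O(1)`. -/
structure CorrelatedErrors (D : (n : ℕ) → EgoDesign n) {Ω : ℕ → Type*}
    [∀ n, MeasurableSpace (Ω n)] (P : (n : ℕ) → Measure (Ω n))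
    (t : (n : ℕ) → Fin (D n).K → Ω n → Bool) (ε : (n : ℕ) → Fin n → Ω n → ℝ) : Prop where
  measurable : ∀ n i, Measurable (ε n i)
  local_dependence : ∀ n (I J : Finset (Fin n)), (∀ i ∈ I, ∀ j ∈ J, j ∉ (D n).ball i 2) →
    IndepFun (fun ω (i : I) => ε n i ω) (fun ω (j : J) => ε n j ω) (P n)
  indep_treat : ∀ n, IndepFun (fun ω i => ε n i ω)
    (fun ω => (D n).treat fun k => t n k ω) (P n)
  memLp_two : ∀ n i, MemLp (ε n i) 2 (P n)
  mean_zero : ∀ n i, ∫ ω, ε n i ω ∂(P n) = 0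
  variance_bdd : ∃ M : ℝ, ∀ n i, variance (ε n i) (P n) ≤ M
  cov_sum : (fun n => (D n).covSum (P n) (ε n)) =O[atTop] (fun _ : ℕ => (1 : ℝ))

end

/-! The argument linearises the least squares estimator and proves a central limit theorem for the
linear term by a characteristic function version of Stein's method.

Linearisation. The normal equations say that `XᵀX / n` maps `√n` times the estimation error to the
score `Xᵀε / √n`. The mean of `XᵀX / n` is explicit: regressing `ρ` on `1` and `T` in mean leaves
residual variance `b / 4`, so a lower bound on `b` gives a bounded inverse `meanGramInv`. If the
Gram matrix is close to its mean, it is invertible, and replacing its inverse by `meanGramInv` costs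
at most a constant times (Gram deviation) × (score). The rows of `meanGramInv` turn the score into
`∑ W_i ε_i / √n`, with `W = Wgamma` for the last row and `W = Wtau` for the sum of the last two
(`abs_ols_sub_le`). Second moment bounds make the expected remainder of order `n^(-3/2)` times the
number of dependent pairs, which is at most `∑ |N_i|² = o(n^(3/2))`. By Markov's inequality the
remainder vanishes in probability, and the convention for a singular `XᵀX` plays no role.

Central limit theorem. The summand `W_i ε_i` is a function of the cluster treatments met by the
neighbourhood of `i` and of `ε_i`. Since `Λ_{ij} = 0` forces disjoint sets of clusters and graph
distance more than two, `Λ` is a dependency matrix for these summands (`isDependencyMatrix_Lam`).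
For a standardised sum `S = ∑ X_i`, let `Y_i` be the part of `S` dependent on `X_i`. Then `E X_i
exp(iu(S - Y_i)) = 0`, and a Taylor expansion shows that `φ(u) = E exp(iuS)` nearly solves `φ' =
-uφ`. The error consists of the fluctuation of `∑ X_i Y_i` about its mean `1`, whose second moment
is bounded by counting walks of length three in `Λ`, and of a third order term bounded by `∑
|N_i|²`. Fourth moments of the errors and `σ² ≥ c > 0` make both vanish under the growth conditions.
Convergence of characteristic functions then gives the normal limit. -/

/-- A quadratic bound for the second order Taylor remainder of `x ↦ exp (i x)`. -/
theorem norm_exp_ofReal_mul_I_sub_one_sub_le (x : ℝ) :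
    ‖Complex.exp (x * Complex.I) - 1 - x * Complex.I‖ ≤ 3 * x ^ 2 := by
  have hn : ‖(x : ℂ) * Complex.I‖ = |x| := by simp
  by_cases h : |x| ≤ 1
  · have := Complex.norm_exp_sub_one_sub_id_le (x := (x : ℂ) * Complex.I) (by rw [hn]; exact h)
    rw [hn, sq_abs] at this
    nlinarith [sq_nonneg x]
  · push Not at h
    calc ‖Complex.exp (x * Complex.I) - 1 - x * Complex.I‖
        ≤ ‖Complex.exp (x * Complex.I)‖ + ‖(1 : ℂ)‖ + ‖(x : ℂ) * Complex.I‖ :=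
          (norm_sub_le _ _).trans (add_le_add_left (norm_sub_le _ _) _)
      _ = 2 + |x| := by rw [Complex.norm_exp_ofReal_mul_I, hn, norm_one]; ring
      _ ≤ 3 * x ^ 2 := by rw [← sq_abs x]; nlinarith

/-! ### The Stein–Tikhomirov method for characteristic functions -/

section CharFun

variable {Ω ι : Type*} [MeasurableSpace Ω] [Fintype ι]

/-- If the derivative of `φ` is close to `-u φ(u)`, then `φ` is close to the characteristic
function of the standard normal law. -/
theorem norm_sub_exp_neg_sq_le_of_hasDerivAt {φ φ' : ℝ → ℂ} (hφ : ∀ u, HasDerivAt φ (φ' u) u)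
    (h0 : φ 0 = 1) {a b : ℝ} (ha : 0 ≤ a) (hb : 0 ≤ b)
    (h : ∀ u, ‖φ' u + u * φ u‖ ≤ |u| * a + u ^ 2 * b) (s : ℝ) :
    ‖φ s - Complex.exp (-(s : ℂ) ^ 2 / 2)‖ ≤ |s| * (|s| * a + s ^ 2 * b) := by
  have hE : ∀ u : ℝ, HasDerivAt (fun u : ℝ => Complex.exp ((u : ℂ) ^ 2 / 2))
      (Complex.exp ((u : ℂ) ^ 2 / 2) * u) u := fun u => by
    have h1 : HasDerivAt (fun z : ℂ => Complex.exp (z ^ 2 / 2))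
        (Complex.exp ((u : ℂ) ^ 2 / 2) * u) u := by
      have : HasDerivAt (fun z : ℂ => z ^ 2 / 2) (u : ℂ) u := by
        have := (hasDerivAt_pow 2 (u : ℂ)).div_const 2
        simpa using this
      exact this.cexp
    exact h1.comp_ofReal
  have hg : ∀ u : ℝ, HasDerivAt (fun u : ℝ => Complex.exp ((u : ℂ) ^ 2 / 2) * φ u)
      (Complex.exp ((u : ℂ) ^ 2 / 2) * (φ' u + u * φ u)) u := fun u => by
    refine ((hE u).mul (hφ u)).congr_deriv ?_
    ring
  have hnorm : ∀ u : ℝ, ‖Complex.exp ((u : ℂ) ^ 2 / 2)‖ = Real.exp (u ^ 2 / 2) := fun u => by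
    have : ((u : ℂ) ^ 2 / 2) = ((u ^ 2 / 2 : ℝ) : ℂ) := by push_cast; rfl
    rw [this, Complex.norm_exp_ofReal]
  -- With the integrating factor `exp(u² / 2)`, the derivative of the product involves only `φ' +
  -- uφ`, and the mean value inequality bounds its departure from `1`. The symmetric interval covers
  -- both signs of `s`; the constant `exp(s² / 2)` cancels when the integrating factor is divided
  -- out.
  have key := Convex.norm_image_sub_le_of_norm_hasDerivWithin_le (𝕜 := ℝ)
    (f := fun u : ℝ => Complex.exp ((u : ℂ) ^ 2 / 2) * φ u)
    (f' := fun u : ℝ => Complex.exp ((u : ℂ) ^ 2 / 2) * (φ' u + u * φ u))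
    (s := Set.Icc (-|s|) |s|) (x := 0) (y := s)
    (C := Real.exp (s ^ 2 / 2) * (|s| * a + s ^ 2 * b))
    (fun u _ => (hg u).hasDerivWithinAt)
    (fun u hu => by
      have hus : |u| ≤ |s| := abs_le.2 hu
      have hus2 : u ^ 2 ≤ s ^ 2 := sq_le_sq.2 hus
      rw [norm_mul, hnorm]
      gcongr
      exact (h u).trans (by gcongr))
    (convex_Icc _ _) ⟨by simp, by simp⟩ (abs_le.1 le_rfl)
  simp only [h0, Complex.ofReal_zero, sub_zero] at key
  have hexp : Complex.exp (-(s : ℂ) ^ 2 / 2) * Complex.exp ((s : ℂ) ^ 2 / 2) = 1 := by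
    rw [← Complex.exp_add]; ring_nf; simp
  have heq : φ s - Complex.exp (-(s : ℂ) ^ 2 / 2) = Complex.exp (-(s : ℂ) ^ 2 / 2) *
      (Complex.exp ((s : ℂ) ^ 2 / 2) * φ s - Complex.exp ((0 : ℂ) ^ 2 / 2) * 1) := by
    rw [mul_sub, ← mul_assoc, hexp]; simp
  have hn2 : ‖Complex.exp (-(s : ℂ) ^ 2 / 2)‖ = Real.exp (-(s ^ 2 / 2)) := by
    have : (-(s : ℂ) ^ 2 / 2) = ((-(s ^ 2 / 2) : ℝ) : ℂ) := by push_cast; ring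
    rw [this, Complex.norm_exp_ofReal]
  rw [heq, norm_mul, hn2]
  calc Real.exp (-(s ^ 2 / 2)) * _
      ≤ Real.exp (-(s ^ 2 / 2)) *
        (Real.exp (s ^ 2 / 2) * (|s| * a + s ^ 2 * b) * ‖s‖) := by gcongr
    _ = (Real.exp (-(s ^ 2 / 2)) * Real.exp (s ^ 2 / 2)) * (|s| * (|s| * a + s ^ 2 * b)) := by
        rw [Real.norm_eq_abs]; ring
    _ = _ := by rw [← Real.exp_add]; simp

variable (P : Measure Ω) [IsProbabilityMeasure P]

/-- The Stein--Tikhomirov bound for characteristic functions of sums with local dependence: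
`Y i` is the part of the sum that depends on `X i`. -/
theorem norm_integral_exp_sub_exp_neg_sq_le (X Y : ι → Ω → ℝ) (hX : ∀ i, Measurable (X i))
    (hY : ∀ i, Measurable (Y i)) (hX1 : ∀ i, Integrable (X i) P)
    (hXY : ∀ i, Integrable (fun ω => X i ω * Y i ω) P)
    (hXYY : ∀ i, Integrable (fun ω => |X i ω| * Y i ω ^ 2) P)
    (hzero : ∀ i (u : ℝ), ∫ ω, (X i ω : ℂ) *
      Complex.exp ((u * (∑ j, X j ω - Y i ω) : ℝ) * Complex.I) ∂P = 0) (s : ℝ) :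
    ‖∫ ω, Complex.exp ((s * ∑ i, X i ω : ℝ) * Complex.I) ∂P - Complex.exp (-(s : ℂ) ^ 2 / 2)‖
      ≤ |s| * (|s| * (∫ ω, |∑ i, X i ω * Y i ω - 1| ∂P)
        + s ^ 2 * (3 * ∑ i, ∫ ω, |X i ω| * Y i ω ^ 2 ∂P)) := by
  set S : Ω → ℝ := fun ω => ∑ i, X i ω with hS
  have hSm : Measurable S := by fun_prop
  have hSi : Integrable S P := integrable_finsetSum _ fun i _ => hX1 i
  set e : ℝ → Ω → ℂ := fun u ω => Complex.exp ((u * S ω : ℝ) * Complex.I) with he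
  have hem : ∀ u, Measurable (e u) := fun u => by fun_prop
  have hen : ∀ u ω, ‖e u ω‖ = 1 := fun u ω => Complex.norm_exp_ofReal_mul_I _
  have hei : ∀ u, Integrable (e u) P := fun u =>
    Integrable.of_bound (hem u).aestronglyMeasurable 1 (Eventually.of_forall fun ω => (hen u ω).le)
  have hed : ∀ u ω, HasDerivAt (fun u => e u ω) (e u ω * (S ω * Complex.I)) u := fun u ω => by
    have h1 : HasDerivAt (fun z : ℂ => Complex.exp (z * (S ω * Complex.I)))
        (Complex.exp ((u : ℂ) * (S ω * Complex.I)) * (S ω * Complex.I)) u := by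
      have : HasDerivAt (fun z : ℂ => z * (S ω * Complex.I)) (S ω * Complex.I) u := by
        simpa using (hasDerivAt_id (u : ℂ)).mul_const (S ω * Complex.I)
      exact this.cexp
    have h2 := h1.comp_ofReal
    simp only [he]
    push_cast
    simpa only [mul_assoc] using h2
  have hder : ∀ u, HasDerivAt (fun u => ∫ ω, e u ω ∂P)
      (∫ ω, e u ω * (S ω * Complex.I) ∂P) u := fun u =>
    (hasDerivAt_integral_of_dominated_loc_of_deriv_le (bound := fun ω => |S ω|) Filter.univ_mem
      (Eventually.of_forall fun u => (hem u).aestronglyMeasurable) (hei u)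
      (by fun_prop) (Eventually.of_forall fun ω u _ => by
        rw [norm_mul, hen, one_mul, norm_mul, Complex.norm_I, mul_one, Complex.norm_real,
          Real.norm_eq_abs]) hSi.abs
      (Eventually.of_forall fun ω u _ => hed u ω)).2
  have hiV : Integrable (fun ω => ∑ i, X i ω * Y i ω) P := integrable_finsetSum _ fun i _ => hXY i
  have hiV1 : Integrable (fun ω => |∑ i, X i ω * Y i ω - 1|) P :=
    (hiV.sub (integrable_const 1)).abs
  have hiR : Integrable (fun ω => ∑ i, |X i ω| * Y i ω ^ 2) P :=
    integrable_finsetSum _ fun i _ => hXYY i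
  refine norm_sub_exp_neg_sq_le_of_hasDerivAt hder (by simp [he])
    (integral_nonneg fun _ => abs_nonneg _)
    (mul_nonneg (by norm_num) (Finset.sum_nonneg fun i _ => integral_nonneg fun ω => by positivity))
    (fun u => ?_) s
  set w : ι → Ω → ℂ := fun i ω =>
    (X i ω : ℂ) * Complex.exp ((u * (S ω - Y i ω) : ℝ) * Complex.I) with hw
  have hwi : ∀ i, Integrable (w i) P := fun i => by
    refine (hX1 i).ofReal.mul_bdd (c := 1) (by fun_prop) (Eventually.of_forall fun ω => ?_)
    exact (Complex.norm_exp_ofReal_mul_I _).le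
  have hXe : ∀ i, Integrable (fun ω => (X i ω : ℂ) * e u ω) P := fun i =>
    (hX1 i).ofReal.mul_bdd (c := 1) (by fun_prop) (Eventually.of_forall fun ω => (hen u ω).le)
  -- The terms `w i` have mean zero by `hzero`, so subtracting them is free and leaves only the
  -- effect of deleting `Y i` from the exponent.
  have hrew : ∫ ω, e u ω * (S ω * Complex.I) ∂P + u * ∫ ω, e u ω ∂P =
      ∫ ω, (Complex.I * ∑ i, ((X i ω : ℂ) * e u ω - w i ω) + u * e u ω) ∂P := by
    rw [integral_add, integral_const_mul, integral_const_mul, integral_finsetSum]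
    · congr 1
      have : ∀ i, ∫ ω, ((X i ω : ℂ) * e u ω - w i ω) ∂P = ∫ ω, (X i ω : ℂ) * e u ω ∂P := fun i => by
        rw [integral_sub (hXe i) (hwi i), hzero i u, sub_zero]
      simp_rw [this]
      rw [← integral_finsetSum _ fun i _ => hXe i, ← integral_const_mul]
      congr 1
      ext ω
      simp only [hS, Complex.ofReal_sum, ← Finset.sum_mul]
      ring
    · exact fun i _ => (hXe i).sub (hwi i)
    · exact (integrable_finsetSum _ fun i _ => (hXe i).sub (hwi i)).const_mul _
    · exact (hei u).const_mul _
  rw [hrew]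
  have hpt : ∀ ω, ‖Complex.I * ∑ i, ((X i ω : ℂ) * e u ω - w i ω) + u * e u ω‖ ≤
      |u| * |∑ i, X i ω * Y i ω - 1| + u ^ 2 * (3 * ∑ i, |X i ω| * Y i ω ^ 2) := fun ω => by
    have h1 : ∀ i, w i ω = (X i ω : ℂ) * e u ω * Complex.exp ((-(u * Y i ω) : ℝ) * Complex.I) := by
      intro i
      simp only [hw, he]
      rw [mul_assoc, ← Complex.exp_add]
      push_cast
      ring_nf
    -- Expand `exp(-iuY_i)` to first order: the linear parts add up to `-u ∑ X_i Y_i`, the extra `u`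
    -- turns this into the deviation of `∑ X_i Y_i` from `1`, and what remains is the Taylor
    -- remainder.
    have h2 : Complex.I * ∑ i, ((X i ω : ℂ) * e u ω - w i ω) + u * e u ω =
        -(u * e u ω * ((∑ i, X i ω * Y i ω - 1 : ℝ) : ℂ)) -
        ∑ i, Complex.I * (X i ω : ℂ) * e u ω *
          (Complex.exp ((-(u * Y i ω) : ℝ) * Complex.I) - 1 - (-(u * Y i ω) : ℝ) * Complex.I) := by
      have h3 : ∀ i, Complex.I * ((X i ω : ℂ) * e u ω - w i ω) =
          -(u * e u ω * ((X i ω : ℂ) * Y i ω)) - Complex.I * (X i ω : ℂ) * e u ω *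
          (Complex.exp ((-(u * Y i ω) : ℝ) * Complex.I) - 1 -
            (-(u * Y i ω) : ℝ) * Complex.I) := fun i => by
        rw [h1 i]
        push_cast
        linear_combination (u * e u ω * X i ω * Y i ω) * Complex.I_sq
      rw [Finset.mul_sum, Finset.sum_congr rfl fun i _ => h3 i, Finset.sum_sub_distrib,
        Finset.sum_neg_distrib, ← Finset.mul_sum]
      push_cast
      ring
    rw [h2]
    refine (norm_sub_le _ _).trans (add_le_add ?_ ?_)
    · rw [norm_neg, norm_mul, norm_mul, hen, Complex.norm_real, Complex.norm_real]
      simp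
    · refine (norm_sum_le _ _).trans ?_
      rw [Finset.mul_sum, Finset.mul_sum]
      refine Finset.sum_le_sum fun i _ => ?_
      rw [norm_mul, norm_mul, norm_mul, hen, Complex.norm_I, Complex.norm_real, one_mul, mul_one,
        Real.norm_eq_abs]
      calc |X i ω| * _ ≤ |X i ω| * (3 * (-(u * Y i ω)) ^ 2) := by
            gcongr
            exact norm_exp_ofReal_mul_I_sub_one_sub_le _
        _ = _ := by ring
  refine (norm_integral_le_of_norm_le (g := fun ω => |u| * |∑ i, X i ω * Y i ω - 1|
    + u ^ 2 * (3 * ∑ i, |X i ω| * Y i ω ^ 2)) ?_ (Eventually.of_forall hpt)).trans_eq ?_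
  · exact (hiV1.const_mul _).add ((hiR.const_mul _).const_mul _)
  · rw [integral_add (hiV1.const_mul _)
      ((hiR.const_mul _).const_mul _), integral_const_mul, integral_const_mul, integral_const_mul,
      integral_finsetSum _ fun i _ => hXYY i]

end CharFun

/-! ### Mixed moments controlled by fourth moments -/

section FourthMoments

variable {Ω : Type*} [MeasurableSpace Ω] {P : Measure Ω}

theorem abs_mul_four_le (a b c d : ℝ) :
    |a * b * c * d| ≤ (a ^ 4 + b ^ 4 + c ^ 4 + d ^ 4) / 4 := by
  have h1 : |a * b * c * d| ≤ ((a * b) ^ 2 + (c * d) ^ 2) / 2 := by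
    rw [abs_le]
    constructor <;> nlinarith [sq_nonneg (a * b + c * d), sq_nonneg (a * b - c * d)]
  nlinarith [sq_nonneg (a ^ 2 - b ^ 2), sq_nonneg (c ^ 2 - d ^ 2)]

theorem integrable_mul_four {f g h k : Ω → ℝ} (hf : Measurable f) (hg : Measurable g)
    (hh : Measurable h) (hk : Measurable k) (hf4 : Integrable (fun ω => f ω ^ 4) P)
    (hg4 : Integrable (fun ω => g ω ^ 4) P) (hh4 : Integrable (fun ω => h ω ^ 4) P)
    (hk4 : Integrable (fun ω => k ω ^ 4) P) :
    Integrable (fun ω => f ω * g ω * h ω * k ω) P :=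
  ((((hf4.add hg4).add hh4).add hk4).div_const 4).mono' (by fun_prop)
    (Eventually.of_forall fun _ => abs_mul_four_le _ _ _ _)

theorem integral_abs_mul_four_le {f g h k : Ω → ℝ} (hf4 : Integrable (fun ω => f ω ^ 4) P)
    (hg4 : Integrable (fun ω => g ω ^ 4) P) (hh4 : Integrable (fun ω => h ω ^ 4) P)
    (hk4 : Integrable (fun ω => k ω ^ 4) P) {C : ℝ} (hf : ∫ ω, f ω ^ 4 ∂P ≤ C)
    (hg : ∫ ω, g ω ^ 4 ∂P ≤ C) (hh : ∫ ω, h ω ^ 4 ∂P ≤ C) (hk : ∫ ω, k ω ^ 4 ∂P ≤ C) :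
    ∫ ω, |f ω * g ω * h ω * k ω| ∂P ≤ C := by
  calc ∫ ω, |f ω * g ω * h ω * k ω| ∂P
      ≤ ∫ ω, (f ω ^ 4 + g ω ^ 4 + h ω ^ 4 + k ω ^ 4) / 4 ∂P :=
        integral_mono_of_nonneg (Eventually.of_forall fun _ => abs_nonneg _)
          ((((hf4.add hg4).add hh4).add hk4).div_const 4)
          (Eventually.of_forall fun _ => abs_mul_four_le _ _ _ _)
    _ = ((∫ ω, f ω ^ 4 ∂P) + (∫ ω, g ω ^ 4 ∂P) + (∫ ω, h ω ^ 4 ∂P) + ∫ ω, k ω ^ 4 ∂P) / 4 := by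
        rw [integral_div, integral_add (by fun_prop) hk4, integral_add (by fun_prop) hh4,
          integral_add hf4 hg4]
    _ ≤ C := by linarith

/-- The second moment of a sum is at most the sum of entrywise bounds on the mixed moments. -/
theorem integral_sum_sq_le {κ : Type*} (s : Finset κ) (Y : κ → Ω → ℝ) (B : κ → κ → ℝ)
    (hint : ∀ p ∈ s, ∀ q ∈ s, Integrable (fun ω => Y p ω * Y q ω) P)
    (hB : ∀ p ∈ s, ∀ q ∈ s, ∫ ω, Y p ω * Y q ω ∂P ≤ B p q) :
    ∫ ω, (∑ p ∈ s, Y p ω) ^ 2 ∂P ≤ ∑ p ∈ s, ∑ q ∈ s, B p q := by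
  simp_rw [sq, Finset.sum_mul_sum]
  rw [integral_finsetSum _ fun p hp => integrable_finsetSum _ fun q hq => hint p hp q hq]
  refine Finset.sum_le_sum fun p hp => ?_
  rw [integral_finsetSum _ fun q hq => hint p hp q hq]
  exact Finset.sum_le_sum fun q hq => hB p hp q hq

/-- This is nonnegativity of the variance of `|f|`. -/
theorem integral_abs_le_sqrt_integral_sq [IsProbabilityMeasure P] {f : Ω → ℝ} (hf : Measurable f)
    (hf2 : Integrable (fun ω => f ω ^ 2) P) :
    ∫ ω, |f ω| ∂P ≤ Real.sqrt (∫ ω, f ω ^ 2 ∂P) := by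
  have hm : MemLp (fun ω => |f ω|) 2 P :=
    (memLp_two_iff_integrable_sq (by fun_prop)).2 (by simpa using hf2)
  have := variance_nonneg (fun ω => |f ω|) P
  rw [variance_eq_sub hm] at this
  refine Real.le_sqrt_of_sq_le ?_
  simp only [Pi.pow_apply, sq_abs] at this
  linarith

end FourthMoments

/-! ### Sums of variables with a dependency matrix -/

/-- `L` is a dependency matrix for the family `X`: a symmetric `0`-`1` matrix such that subfamilies
with no entry `1` between them are independent. -/
structure IsDependencyMatrix {Ω ι : Type*} [MeasurableSpace Ω] (P : Measure Ω)
    (L : ι → ι → ℝ) (X : ι → Ω → ℝ) : Prop where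
  zero_or_one : ∀ i j, L i j = 0 ∨ L i j = 1
  symm : ∀ i j, L i j = L j i
  indep : ∀ I J : Finset ι, (∀ i ∈ I, ∀ j ∈ J, L i j = 0) →
    IndepFun (fun ω (i : I) => X i ω) (fun ω (j : J) => X j ω) P

namespace IsDependencyMatrix

variable {Ω ι : Type*} [MeasurableSpace Ω] {P : Measure Ω} {L : ι → ι → ℝ} {X : ι → Ω → ℝ}

theorem nonneg (h : IsDependencyMatrix P L X) (i j : ι) : 0 ≤ L i j := by
  rcases h.zero_or_one i j with h | h <;> simp [h]

theorem const_mul (h : IsDependencyMatrix P L X) (c : ℝ) :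
    IsDependencyMatrix P L (fun i ω => c * X i ω) where
  zero_or_one := h.zero_or_one
  symm := h.symm
  indep I J hIJ := (h.indep I J hIJ).comp (φ := fun (f : I → ℝ) i => c * f i)
    (ψ := fun (f : J → ℝ) j => c * f j)
    (by fun_prop) (by fun_prop)

theorem indepFun (h : IsDependencyMatrix P L X) {i j : ι} (hij : L i j = 0) :
    IndepFun (X i) (X j) P :=
  (h.indep {i} {j} (by simpa using hij)).comp (φ := fun f : ({i} : Finset ι) → ℝ => f ⟨i, by simp⟩)
    (ψ := fun f : ({j} : Finset ι) → ℝ => f ⟨j, by simp⟩) (by fun_prop) (by fun_prop)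

theorem indepFun_mul (h : IsDependencyMatrix P L X) {i j k l : ι} (hik : L i k = 0)
    (hil : L i l = 0) (hjk : L j k = 0) (hjl : L j l = 0) :
    IndepFun (fun ω => X i ω * X j ω) (fun ω => X k ω * X l ω) P := by
  classical
  refine (h.indep {i, j} {k, l} ?_).comp
    (φ := fun f : ({i, j} : Finset ι) → ℝ => f ⟨i, by simp⟩ * f ⟨j, by simp⟩)
    (ψ := fun f : ({k, l} : Finset ι) → ℝ => f ⟨k, by simp⟩ * f ⟨l, by simp⟩) (by fun_prop) (by fun_prop)
  simp [hik, hil, hjk, hjl]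

variable [Fintype ι]

/-- Removing the terms `L i j * X j` leaves exactly the `X j` with `L i j = 0`, which are jointly
independent of `X i`, so the expectation factors and the zero mean of `X i` kills it. This supplies
`hzero` in `norm_integral_exp_sub_exp_neg_sq_le`. -/
theorem integral_mul_exp_eq_zero (h : IsDependencyMatrix P L X) (hX : ∀ i, Measurable (X i))
    (hmean : ∀ i, ∫ ω, X i ω ∂P = 0) (i : ι) (u : ℝ) :
    ∫ ω, (X i ω : ℂ) * Complex.exp ((u * (∑ j, X j ω - ∑ j, L i j * X j ω) : ℝ) * Complex.I) ∂P
      = 0 := by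
  classical
  set J : Finset ι := {j | L i j = 0} with hJ
  have hsum : ∀ ω, ∑ j, X j ω - ∑ j, L i j * X j ω = ∑ j : J, X j ω := fun ω => by
    rw [← Finset.sum_sub_distrib, Finset.sum_coe_sort J (fun j => X j ω), hJ, Finset.sum_filter]
    refine Finset.sum_congr rfl fun j _ => ?_
    rcases h.zero_or_one i j with h | h <;> simp [h]
  have hind : IndepFun (fun ω => (X i ω : ℂ))
      (fun ω => Complex.exp ((u * ∑ j : J, X j ω : ℝ) * Complex.I)) P :=
    (h.indep {i} J (by simp [hJ])).comp (φ := fun f : ({i} : Finset ι) → ℝ => ((f ⟨i, by simp⟩ : ℝ) : ℂ))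
      (ψ := fun f : J → ℝ => Complex.exp ((u * ∑ j : J, f j : ℝ) * Complex.I))
      (by fun_prop) (by fun_prop)
  simp_rw [hsum]
  rw [hind.integral_fun_mul_eq_mul_integral (by fun_prop) (by fun_prop), integral_complex_ofReal, hmean]
  simp

/-- The variance of a sum of uncorrelated-off-the-graph variables. -/
theorem integral_sum_sub_sq_le [IsProbabilityMeasure P] (h : IsDependencyMatrix P L X) (hX : ∀ i, MemLp (X i) 2 P)
    (m : ι → ℝ) (hm : ∀ i, ∫ ω, X i ω ∂P = m i) {C : ℝ} (hC : ∀ i, ∫ ω, X i ω ^ 2 ∂P ≤ C) :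
    ∫ ω, (∑ i, X i ω - ∑ i, m i) ^ 2 ∂P ≤ C * ∑ i, ∑ j, L i j := by
  have hint : ∀ i j, Integrable (fun ω => X i ω * X j ω) P := fun i j =>
    (hX i).integrable_mul (hX j)
  have hcov : ∀ i j, ∫ ω, (X i ω - m i) * (X j ω - m j) ∂P
      = ∫ ω, X i ω * X j ω ∂P - m i * m j := fun i j => by
    have h1 : ∀ ω, (X i ω - m i) * (X j ω - m j)
        = X i ω * X j ω - (m j * X i ω + m i * X j ω) + m i * m j := fun ω => by ring
    simp_rw [h1]
    have hi := (hX i).integrable (by norm_num)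
    have hj := (hX j).integrable (by norm_num)
    rw [integral_add (by fun_prop) (by fun_prop), integral_sub (hint i j) (by fun_prop),
      integral_add (by fun_prop) (by fun_prop), integral_const_mul, integral_const_mul, hm, hm]
    simp
    ring
  have hcent : ∀ i, MemLp (fun ω => X i ω - m i) 2 P := fun i => (hX i).sub (memLp_const _)
  have hsq : ∀ i, ∫ ω, (X i ω - m i) ^ 2 ∂P ≤ C := fun i => by
    simp_rw [sq]
    rw [hcov]
    have := hC i
    simp_rw [sq] at this
    nlinarith [sq_nonneg (m i)]
  simp_rw [← Finset.sum_sub_distrib, Finset.mul_sum]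
  refine integral_sum_sq_le _ _ (fun i j => C * L i j)
    (fun i _ j _ => (hcent i).integrable_mul (hcent j)) fun i _ j _ => ?_
  -- Independent pairs have covariance zero; for the others `2ab ≤ a² + b²` bounds the covariance by
  -- `C`. Both cases read `C * L i j`.
  rcases h.zero_or_one i j with h0 | h1
  · rw [hcov, (h.indepFun h0).integral_fun_mul_eq_mul_integral (hX i).1 (hX j).1, hm, hm, h0]
    simp
  · rw [h1, mul_one]
    calc ∫ ω, (X i ω - m i) * (X j ω - m j) ∂P
        ≤ ∫ ω, ((X i ω - m i) ^ 2 + (X j ω - m j) ^ 2) / 2 ∂P :=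
          integral_mono ((hcent i).integrable_mul (hcent j))
            (((hcent i).integrable_sq.add (hcent j).integrable_sq).div_const 2)
            fun ω => by nlinarith [sq_nonneg ((X i ω - m i) - (X j ω - m j))]
      _ ≤ C := by
          rw [integral_div, integral_add (hcent i).integrable_sq (hcent j).integrable_sq]
          linarith [hsq i, hsq j]

end IsDependencyMatrix

namespace IsDependencyMatrix

variable {Ω ι : Type*} [MeasurableSpace Ω] {P : Measure Ω} {L : ι → ι → ℝ} {X : ι → Ω → ℝ}
variable [Fintype ι]

/-- The total of the third power of a matrix, as a sum over walks. -/
theorem _root_.Matrix.sum_pow_three_apply [DecidableEq ι] (A : Matrix ι ι ℝ) :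
    ∑ i, ∑ j, (A ^ 3) i j = ∑ i, ∑ j, ∑ k, ∑ l, A i j * A j k * A k l := by
  simp_rw [pow_succ, pow_zero, one_mul, Matrix.mul_apply, Finset.sum_mul]
  refine Finset.sum_congr rfl fun i _ => ?_
  rw [Finset.sum_comm]
  conv_rhs => rw [Finset.sum_comm]
  exact Finset.sum_congr rfl fun k _ => Finset.sum_comm

/-- Each of the four summands joins the edges `(i, j)` and `(k, l)` by a third edge. After
relabelling by symmetry, each product is a walk of length three. -/
theorem sum_mul_mul_add_eq [DecidableEq ι] (h : IsDependencyMatrix P L X) :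
    ∑ i, ∑ j, ∑ k, ∑ l, L i j * L k l * (L i k + L i l + L j k + L j l)
      = 4 * ∑ i, ∑ j, (Matrix.of L ^ 3) i j := by
  have h1 : ∑ i, ∑ j, ∑ k, ∑ l, L i j * L k l * L j k = ∑ i, ∑ j, (Matrix.of L ^ 3) i j := by
    rw [Matrix.sum_pow_three_apply]
    simp only [mul_right_comm, Matrix.of_apply]
  have h2 : ∑ i, ∑ j, ∑ k, ∑ l, L i j * L k l * L i k = ∑ i, ∑ j, (Matrix.of L ^ 3) i j := by
    rw [← h1, Finset.sum_comm]
    simp only [h.symm]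
  have h3 : ∑ i, ∑ j, ∑ k, ∑ l, L i j * L k l * L j l = ∑ i, ∑ j, (Matrix.of L ^ 3) i j := by
    rw [← h1]
    refine Finset.sum_congr rfl fun i _ => Finset.sum_congr rfl fun j _ => ?_
    rw [Finset.sum_comm]
    simp only [h.symm]
  have h4 : ∑ i, ∑ j, ∑ k, ∑ l, L i j * L k l * L i l = ∑ i, ∑ j, (Matrix.of L ^ 3) i j := by
    rw [← h3, Finset.sum_comm]
    simp only [h.symm]
  simp only [mul_add, Finset.sum_add_distrib, h1, h2, h3, h4]
  ring

/-- The fluctuations of `∑ L i j X i X j`. -/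
theorem integral_quadratic_sub_sq_le [IsProbabilityMeasure P] [DecidableEq ι] (h : IsDependencyMatrix P L X)
    (hX : ∀ i, Measurable (X i)) (hX4 : ∀ i, Integrable (fun ω => X i ω ^ 4) P) {C : ℝ}
    (hC1 : 1 ≤ C) (hC : ∀ i, ∫ ω, X i ω ^ 4 ∂P ≤ C) :
    ∫ ω, (∑ i, X i ω * ∑ j, L i j * X j ω - ∑ i, ∑ j, L i j * ∫ ω', X i ω' * X j ω' ∂P) ^ 2 ∂P
      ≤ 8 * C ^ 2 * ∑ i, ∑ j, (Matrix.of L ^ 3) i j := by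
  -- The constant `1` pads products of two variables to products of four, so one bound serves both;
  -- this is where `1 ≤ C` enters.
  have h14 : Integrable (fun _ : Ω => (1 : ℝ) ^ 4) P := integrable_const _
  have h1C : ∫ _, (1 : ℝ) ^ 4 ∂P ≤ C := by simpa using hC1
  have hi2 : ∀ i j, Integrable (fun ω => X i ω * X j ω) P := fun i j => by
    simpa using integrable_mul_four (hX i) (hX j) (measurable_const (a := (1 : ℝ)))
      (measurable_const (a := (1 : ℝ))) (hX4 i) (hX4 j) h14 h14
  have hi4 : ∀ i j k l, Integrable (fun ω => X i ω * X j ω * X k ω * X l ω) P := fun i j k l =>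
    integrable_mul_four (hX i) (hX j) (hX k) (hX l) (hX4 i) (hX4 j) (hX4 k) (hX4 l)
  have hb2 : ∀ i j, |∫ ω, X i ω * X j ω ∂P| ≤ C := fun i j => by
    refine abs_integral_le_integral_abs.trans ?_
    simpa using integral_abs_mul_four_le (hX4 i) (hX4 j) h14 h14 (hC i) (hC j) h1C h1C
  have hb4 : ∀ i j k l, ∫ ω, X i ω * X j ω * X k ω * X l ω ∂P ≤ C := fun i j k l =>
    (le_abs_self _).trans (abs_integral_le_integral_abs.trans
      (integral_abs_mul_four_le (hX4 i) (hX4 j) (hX4 k) (hX4 l) (hC i) (hC j) (hC k) (hC l)))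
  set m : ι → ι → ℝ := fun i j => ∫ ω, X i ω * X j ω ∂P with hm
  set Y : ι × ι → Ω → ℝ := fun p ω => L p.1 p.2 * (X p.1 ω * X p.2 ω - m p.1 p.2) with hY
  have hrew : ∀ ω, ∑ i, X i ω * ∑ j, L i j * X j ω - ∑ i, ∑ j, L i j * m i j = ∑ p, Y p ω := by
    intro ω
    rw [Fintype.sum_prod_type, ← Finset.sum_sub_distrib]
    refine Finset.sum_congr rfl fun i _ => ?_
    rw [Finset.mul_sum, ← Finset.sum_sub_distrib]
    exact Finset.sum_congr rfl fun j _ => by simp only [hY]; ring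
  refine (integral_congr_ae (Eventually.of_forall fun ω => congrArg (· ^ 2) (hrew ω))).trans_le ?_
  have hexp : ∀ p q : ι × ι, ∀ ω, Y p ω * Y q ω = (L p.1 p.2 * L q.1 q.2) *
      (X p.1 ω * X p.2 ω * X q.1 ω * X q.2 ω - (m q.1 q.2 * (X p.1 ω * X p.2 ω)
        + m p.1 p.2 * (X q.1 ω * X q.2 ω)) + m p.1 p.2 * m q.1 q.2) := fun p q ω => by
    simp only [hY]; ring
  have hYY : ∀ p q, Integrable (fun ω => Y p ω * Y q ω) P := fun p q => by
    simp_rw [hexp]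
    exact ((((hi4 _ _ _ _).sub (((hi2 _ _).const_mul _).add ((hi2 _ _).const_mul _))).add
      (integrable_const _)).const_mul _)
  have hEYY : ∀ p q, ∫ ω, Y p ω * Y q ω ∂P = (L p.1 p.2 * L q.1 q.2) *
      (∫ ω, X p.1 ω * X p.2 ω * X q.1 ω * X q.2 ω ∂P - m p.1 p.2 * m q.1 q.2) := fun p q => by
    simp_rw [hexp]
    have := hi4 p.1 p.2 q.1 q.2
    have a1 := (hi2 p.1 p.2).const_mul (m q.1 q.2)
    have a2 := (hi2 q.1 q.2).const_mul (m p.1 p.2)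
    rw [integral_const_mul, integral_add (by fun_prop) (by fun_prop),
      integral_sub this (by fun_prop), integral_add a1 a2, integral_const_mul, integral_const_mul,
      integral_const, probReal_univ, one_smul]
    change L p.1 p.2 * L q.1 q.2 * (_ - (m q.1 q.2 * m p.1 p.2 + m p.1 p.2 * m q.1 q.2)
      + m p.1 p.2 * m q.1 q.2) = _
    ring
  refine (integral_sum_sq_le Finset.univ Y (fun p q => 2 * C ^ 2 * (L p.1 p.2 * L q.1 q.2 *
    (L p.1 q.1 + L p.1 q.2 + L p.2 q.1 + L p.2 q.2))) (fun p _ q _ => hYY p q)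
    fun p _ q _ => ?_).trans_eq ?_
  · rw [hEYY]
    have hpq : 0 ≤ L p.1 p.2 * L q.1 q.2 := mul_nonneg (h.nonneg _ _) (h.nonneg _ _)
    have n1 := h.nonneg p.1 q.1
    have n2 := h.nonneg p.1 q.2
    have n3 := h.nonneg p.2 q.1
    have n4 := h.nonneg p.2 q.2
    -- Two pairs without a connecting edge are independent and contribute zero. Otherwise the sum of
    -- the four entries is at least `1` and may multiply the crude bound `C + C² ≤ 2C²`.
    by_cases h0 : L p.1 q.1 = 0 ∧ L p.1 q.2 = 0 ∧ L p.2 q.1 = 0 ∧ L p.2 q.2 = 0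
    · obtain ⟨e1, e2, e3, e4⟩ := h0
      have hind := (h.indepFun_mul e1 e2 e3 e4).integral_fun_mul_eq_mul_integral
        (by fun_prop) (by fun_prop)
      have : ∫ ω, X p.1 ω * X p.2 ω * X q.1 ω * X q.2 ω ∂P = m p.1 p.2 * m q.1 q.2 := by
        rw [← hind]
        simp_rw [mul_assoc]
      rw [this, sub_self, e1, e2, e3, e4]
      simp
    · have h1 : 1 ≤ L p.1 q.1 + L p.1 q.2 + L p.2 q.1 + L p.2 q.2 := by
        rcases h.zero_or_one p.1 q.1 with e1 | e1 <;> rcases h.zero_or_one p.1 q.2 with e2 | e2 <;>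
        rcases h.zero_or_one p.2 q.1 with e3 | e3 <;> rcases h.zero_or_one p.2 q.2 with e4 | e4 <;>
        first | linarith | exact absurd ⟨e1, e2, e3, e4⟩ h0
      have hle : ∫ ω, X p.1 ω * X p.2 ω * X q.1 ω * X q.2 ω ∂P - m p.1 p.2 * m q.1 q.2
          ≤ 2 * C ^ 2 := by
        have c1 := hb4 p.1 p.2 q.1 q.2
        have c2 : |m p.1 p.2 * m q.1 q.2| ≤ C * C := by
          rw [abs_mul]
          exact mul_le_mul (hb2 _ _) (hb2 _ _) (abs_nonneg _) (by linarith)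
        have c3 := neg_abs_le (m p.1 p.2 * m q.1 q.2)
        nlinarith
      calc (L p.1 p.2 * L q.1 q.2) * _ ≤ (L p.1 p.2 * L q.1 q.2) * (2 * C ^ 2 * 1) := by
            rw [mul_one]
            exact mul_le_mul_of_nonneg_left hle hpq
        _ ≤ (L p.1 p.2 * L q.1 q.2) * (2 * C ^ 2 *
            (L p.1 q.1 + L p.1 q.2 + L p.2 q.1 + L p.2 q.2)) := by gcongr
        _ = _ := by ring
  · simp_rw [Fintype.sum_prod_type, ← Finset.mul_sum]
    rw [h.sum_mul_mul_add_eq]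
    ring

/-- Expanding the square leaves absolute mixed third moments, each at most `C`, with weights `L i j
* L i k` that sum to the squared row sum. -/
theorem sum_integral_abs_mul_sq_le [IsProbabilityMeasure P] (h : IsDependencyMatrix P L X)
    (hX : ∀ i, Measurable (X i)) (hX4 : ∀ i, Integrable (fun ω => X i ω ^ 4) P) {C : ℝ}
    (hC1 : 1 ≤ C) (hC : ∀ i, ∫ ω, X i ω ^ 4 ∂P ≤ C) :
    ∑ i, ∫ ω, |X i ω| * (∑ j, L i j * X j ω) ^ 2 ∂P ≤ C * ∑ i, (∑ j, L i j) ^ 2 := by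
  have h14 : Integrable (fun _ : Ω => (1 : ℝ) ^ 4) P := integrable_const _
  have h1C : ∫ _, (1 : ℝ) ^ 4 ∂P ≤ C := by simpa using hC1
  rw [Finset.mul_sum]
  refine Finset.sum_le_sum fun i _ => ?_
  have hi3 : ∀ j k, Integrable (fun ω => |X i ω * X j ω * X k ω|) P := fun j k => by
    simpa using (integrable_mul_four (hX i) (hX j) (hX k)
      (measurable_const (a := (1 : ℝ))) (hX4 i) (hX4 j) (hX4 k) h14).abs
  have hb3 : ∀ j k, ∫ ω, |X i ω * X j ω * X k ω| ∂P ≤ C := fun j k => by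
    simpa using integral_abs_mul_four_le (hX4 i) (hX4 j) (hX4 k) h14 (hC i) (hC j) (hC k) h1C
  calc ∫ ω, |X i ω| * (∑ j, L i j * X j ω) ^ 2 ∂P
      ≤ ∫ ω, ∑ j, ∑ k, L i j * L i k * |X i ω * X j ω * X k ω| ∂P := by
        refine integral_mono_of_nonneg (Eventually.of_forall fun ω => by positivity)
          (integrable_finsetSum _ fun j _ => integrable_finsetSum _ fun k _ =>
            (hi3 j k).const_mul _) (Eventually.of_forall fun ω => ?_)
        simp only
        rw [sq, Finset.sum_mul_sum, Finset.mul_sum]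
        refine Finset.sum_le_sum fun j _ => ?_
        rw [Finset.mul_sum]
        refine Finset.sum_le_sum fun k _ => ?_
        rw [abs_mul, abs_mul]
        calc |X i ω| * (L i j * X j ω * (L i k * X k ω))
            = L i j * L i k * (|X i ω| * (X j ω * X k ω)) := by ring
          _ ≤ L i j * L i k * (|X i ω| * (|X j ω| * |X k ω|)) := by
            have := h.nonneg i j
            have := h.nonneg i k
            refine mul_le_mul_of_nonneg_left (mul_le_mul_of_nonneg_left ?_ (abs_nonneg _))
              (by positivity)
            rw [← abs_mul]
            exact le_abs_self _
          _ = _ := by ring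
    _ = ∑ j, ∑ k, L i j * L i k * ∫ ω, |X i ω * X j ω * X k ω| ∂P := by
        rw [integral_finsetSum _ fun j _ => integrable_finsetSum _ fun k _ =>
            (hi3 j k).const_mul _]
        refine Finset.sum_congr rfl fun j _ => ?_
        rw [integral_finsetSum _ fun k _ => (hi3 j k).const_mul _]
        simp_rw [integral_const_mul]
    _ ≤ ∑ j, ∑ k, L i j * L i k * C := by
        refine Finset.sum_le_sum fun j _ => Finset.sum_le_sum fun k _ =>
          mul_le_mul_of_nonneg_left (hb3 j k) (mul_nonneg (h.nonneg _ _) (h.nonneg _ _))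
    _ = C * (∑ j, L i j) ^ 2 := by
        rw [sq, Finset.sum_mul_sum, Finset.mul_sum]
        simp_rw [Finset.mul_sum]
        exact Finset.sum_congr rfl fun j _ => Finset.sum_congr rfl fun k _ => by ring

/-- A quantitative central limit theorem for sums with a dependency matrix, for characteristic
functions. -/
theorem norm_integral_exp_sub_le [IsProbabilityMeasure P] [DecidableEq ι] (h : IsDependencyMatrix P L X)
    (hX : ∀ i, Measurable (X i)) (hX4 : ∀ i, Integrable (fun ω => X i ω ^ 4) P) {C : ℝ}
    (hC1 : 1 ≤ C) (hC : ∀ i, ∫ ω, X i ω ^ 4 ∂P ≤ C) (hmean : ∀ i, ∫ ω, X i ω ∂P = 0) {v : ℝ}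
    (hv : v = ∑ i, ∑ j, L i j * ∫ ω, X i ω * X j ω ∂P) (hv0 : 0 < v) (s : ℝ) :
    ‖∫ ω, Complex.exp ((s * ((Real.sqrt v)⁻¹ * ∑ i, X i ω) : ℝ) * Complex.I) ∂P
        - Complex.exp (-(s : ℂ) ^ 2 / 2)‖
      ≤ |s| * (|s| * (Real.sqrt (8 * C ^ 2 * ∑ i, ∑ j, (Matrix.of L ^ 3) i j) / v)
        + s ^ 2 * (3 * (C * ∑ i, (∑ j, L i j) ^ 2) / (v * Real.sqrt v))) := by
  have h14 : Integrable (fun _ : Ω => (1 : ℝ) ^ 4) P := integrable_const _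
  have hi1 : ∀ i, Integrable (X i) P := fun i => by
    simpa using integrable_mul_four (hX i) (measurable_const (a := (1 : ℝ)))
      (measurable_const (a := (1 : ℝ))) (measurable_const (a := (1 : ℝ))) (hX4 i) h14 h14 h14
  have hi2 : ∀ i j, Integrable (fun ω => X i ω * X j ω) P := fun i j => by
    simpa using integrable_mul_four (hX i) (hX j) (measurable_const (a := (1 : ℝ)))
      (measurable_const (a := (1 : ℝ))) (hX4 i) (hX4 j) h14 h14
  have hi4 : ∀ i j k l, Integrable (fun ω => X i ω * X j ω * X k ω * X l ω) P := fun i j k l =>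
    integrable_mul_four (hX i) (hX j) (hX k) (hX l) (hX4 i) (hX4 j) (hX4 k) (hX4 l)
  have hi3 : ∀ i j k, Integrable (fun ω => |X i ω| * (X j ω * X k ω)) P := fun i j k => by
    have := (integrable_mul_four (hX i).abs (hX j) (hX k)
      (measurable_const (a := (1 : ℝ))) (by simpa [(show Even 4 by decide).pow_abs] using hX4 i) (hX4 j) (hX4 k) h14)
    simpa [mul_assoc] using this
  -- After this scaling `hv` says that `∑ X_i Y_i` has mean `1`, so the first error term is a
  -- fluctuation about the mean and is bounded in `L²`.
  set c := (Real.sqrt v)⁻¹ with hc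
  have hsv : 0 < Real.sqrt v := Real.sqrt_pos.2 hv0
  have hc0 : 0 < c := inv_pos.2 hsv
  have hcc : c * c = v⁻¹ := by rw [hc, ← mul_inv, Real.mul_self_sqrt hv0.le]
  have hYdef : ∀ i ω, ∑ j, L i j * (c * X j ω) = c * ∑ j, L i j * X j ω := fun i ω => by
    rw [Finset.mul_sum]; exact Finset.sum_congr rfl fun j _ => by ring
  have key := norm_integral_exp_sub_exp_neg_sq_le P (fun i ω => c * X i ω)
    (fun i ω => ∑ j, L i j * (c * X j ω)) (fun i => by fun_prop) (fun i => by fun_prop)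
    (fun i => (hi1 i).const_mul c)
    (fun i => by
      simp_rw [Finset.mul_sum]
      refine integrable_finsetSum _ fun j _ => ?_
      have := (hi2 i j).const_mul (c * L i j * c)
      refine this.congr (Eventually.of_forall fun ω => ?_)
      simp only
      ring)
    (fun i => by
      simp_rw [sq, Finset.sum_mul_sum, Finset.mul_sum]
      refine integrable_finsetSum _ fun j _ => integrable_finsetSum _ fun k _ => ?_
      refine ((hi3 i j k).const_mul (|c| * (L i j * c * L i k * c))).congr
        (Eventually.of_forall fun ω => ?_)
      simp only [abs_mul]
      ring)
    (fun i u => (h.const_mul c).integral_mul_exp_eq_zero (fun i => by fun_prop)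
      (fun i => by rw [integral_const_mul, hmean, mul_zero]) i u) s
  simp_rw [← Finset.mul_sum] at key
  refine key.trans ?_
  have e1 : ∫ ω, |∑ i, c * X i ω * ∑ j, L i j * (c * X j ω) - 1| ∂P
      ≤ Real.sqrt (8 * C ^ 2 * ∑ i, ∑ j, (Matrix.of L ^ 3) i j) / v := by
    have hrew : ∀ ω, |∑ i, c * X i ω * ∑ j, L i j * (c * X j ω) - 1|
        = v⁻¹ * |∑ i, X i ω * ∑ j, L i j * X j ω - v| := fun ω => by
      rw [← abs_of_pos (inv_pos.2 hv0), ← abs_mul, mul_sub, inv_mul_cancel₀ hv0.ne',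
        Finset.mul_sum]
      congr 2
      refine Finset.sum_congr rfl fun i _ => ?_
      rw [hYdef, ← hcc]
      ring
    simp_rw [hrew]
    rw [integral_const_mul, div_eq_inv_mul]
    refine mul_le_mul_of_nonneg_left ?_ (inv_nonneg.2 hv0.le)
    refine (integral_abs_le_sqrt_integral_sq (by fun_prop) ?_).trans (Real.sqrt_le_sqrt ?_)
    · refine MemLp.integrable_sq (MemLp.sub ?_ (memLp_const _))
      refine memLp_finsetSum _ fun i _ => ?_
      simp_rw [Finset.mul_sum]
      refine memLp_finsetSum _ fun j _ => ?_
      refine (memLp_two_iff_integrable_sq (by fun_prop)).2 ?_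
      refine ((hi4 i j i j).const_mul (L i j ^ 2)).congr (Eventually.of_forall fun ω => ?_)
      simp only
      ring
    · rw [hv]
      exact h.integral_quadratic_sub_sq_le hX hX4 hC1 hC
  have e2 : ∑ i, ∫ ω, |c * X i ω| * (∑ j, L i j * (c * X j ω)) ^ 2 ∂P
      ≤ C * (∑ i, (∑ j, L i j) ^ 2) / (v * Real.sqrt v) := by
    have hrew : ∀ i ω, |c * X i ω| * (∑ j, L i j * (c * X j ω)) ^ 2
        = (v * Real.sqrt v)⁻¹ * (|X i ω| * (∑ j, L i j * X j ω) ^ 2) := fun i ω => by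
      rw [hYdef, abs_mul, abs_of_pos hc0, mul_inv, ← hcc, ← hc]
      ring
    simp_rw [hrew, integral_const_mul, ← Finset.mul_sum]
    rw [div_eq_inv_mul]
    refine mul_le_mul_of_nonneg_left ?_ (by positivity)
    exact h.sum_integral_abs_mul_sq_le hX hX4 hC1 hC
  rw [mul_div_assoc]
  gcongr

end IsDependencyMatrix

/-! ### The matrix `Λ` as a dependency matrix for treatments and errors -/

/-- Two independent pairs, which are independent of each other, may be regrouped. -/
theorem ProbabilityTheory.IndepFun.prodMk_prodMk_of_prodMk {Ω α β α' β' : Type*}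
    [MeasurableSpace Ω] [MeasurableSpace α] [MeasurableSpace β] [MeasurableSpace α']
    [MeasurableSpace β'] {P : Measure Ω} [IsProbabilityMeasure P] {f : Ω → α} {f' : Ω → α'}
    {g : Ω → β} {g' : Ω → β'} (hf : Measurable f) (hf' : Measurable f') (hg : Measurable g)
    (hg' : Measurable g') (hff : IndepFun f f' P) (hgg : IndepFun g g' P)
    (h : IndepFun (fun ω => (f ω, f' ω)) (fun ω => (g ω, g' ω)) P) :
    IndepFun (fun ω => (f ω, g ω)) (fun ω => (f' ω, g' ω)) P := by
  rw [indepFun_iff_map_prod_eq_prod_map_map (by fun_prop) (by fun_prop)]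
  have hfg : IndepFun f g P := h.comp measurable_fst measurable_fst
  have hfg' : IndepFun f' g' P := h.comp measurable_snd measurable_snd
  have := Measure.isProbabilityMeasure_map (μ := P) (f := fun ω => (f ω, g ω)) (by fun_prop)
  have := Measure.isProbabilityMeasure_map (μ := P) (f := fun ω => (f' ω, g' ω)) (by fun_prop)
  -- It suffices to compare the two laws on products of rectangles, a generating π-system on which
  -- both sides factor into the same four probabilities.
  refine (Measure.prod_eq_generateFrom (C := Set.image2 (· ×ˢ ·) {s : Set α | MeasurableSet s}
    {s : Set β | MeasurableSet s}) (D := Set.image2 (· ×ˢ ·) {s : Set α' | MeasurableSet s}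
    {s : Set β' | MeasurableSet s}) generateFrom_prod generateFrom_prod isPiSystem_prod
    isPiSystem_prod ?_ ?_ ?_).symm
  · exact ⟨fun _ => Set.univ, fun _ => ⟨_, MeasurableSet.univ, _, MeasurableSet.univ,
      Set.univ_prod_univ⟩, fun _ => measure_lt_top _ _, Set.iUnion_const _⟩
  · exact ⟨fun _ => Set.univ, fun _ => ⟨_, MeasurableSet.univ, _, MeasurableSet.univ,
      Set.univ_prod_univ⟩, fun _ => measure_lt_top _ _, Set.iUnion_const _⟩
  rintro _ ⟨a, ha, b, hb, rfl⟩ _ ⟨a', ha', b', hb', rfl⟩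
  simp only [Set.mem_ofPred_eq] at ha hb ha' hb'
  rw [Measure.map_apply (by fun_prop) ((ha.prod hb).prod (ha'.prod hb')),
    Measure.map_apply (by fun_prop) (ha.prod hb), Measure.map_apply (by fun_prop) (ha'.prod hb')]
  have e1 : P ((fun ω => (f ω, g ω)) ⁻¹' (a ×ˢ b)) = P (f ⁻¹' a) * P (g ⁻¹' b) :=
    hfg.measure_inter_preimage_eq_mul a b ha hb
  have e2 : P ((fun ω => (f' ω, g' ω)) ⁻¹' (a' ×ˢ b')) = P (f' ⁻¹' a') * P (g' ⁻¹' b') :=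
    hfg'.measure_inter_preimage_eq_mul a' b' ha' hb'
  have e3 : P ((fun ω => ((f ω, g ω), (f' ω, g' ω))) ⁻¹' ((a ×ˢ b) ×ˢ (a' ×ˢ b')))
      = P ((fun ω => (f ω, f' ω)) ⁻¹' (a ×ˢ a')) * P ((fun ω => (g ω, g' ω)) ⁻¹' (b ×ˢ b')) := by
    rw [← h.measure_inter_preimage_eq_mul _ _ (ha.prod ha') (hb.prod hb')]
    congr 1
    ext ω
    simp only [Set.mem_preimage, Set.mem_prod, Set.mem_inter_iff]
    tauto
  have e4 : P ((fun ω => (f ω, f' ω)) ⁻¹' (a ×ˢ a')) = P (f ⁻¹' a) * P (f' ⁻¹' a') :=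
    hff.measure_inter_preimage_eq_mul a a' ha ha'
  have e5 : P ((fun ω => (g ω, g' ω)) ⁻¹' (b ×ˢ b')) = P (g ⁻¹' b) * P (g' ⁻¹' b') :=
    hgg.measure_inter_preimage_eq_mul b b' hb hb'
  rw [e1, e2, e3, e4, e5]
  ring

noncomputable section

namespace EgoDesign

variable {n : ℕ} (D : EgoDesign n)

theorem mem_ball {i j : Fin n} {d : ℕ} : j ∈ D.ball i d ↔ D.graph.edist i j ≤ d := by
  simp [ball]

theorem mem_reach {i : Fin n} {k : Fin D.K} :
    k ∈ D.reach i ↔ ∃ j ∈ D.ball i 1, D.e j = k := by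
  simp [reach, cluster, Finset.Nonempty]

theorem e_mem_reach (i : Fin n) : D.e i ∈ D.reach i :=
  D.mem_reach.2 ⟨i, D.mem_ball.2 (by simp), rfl⟩

theorem e_mem_reach_of_mem_nbrs {i j : Fin n} (h : j ∈ D.nbrs i) : D.e j ∈ D.reach i := by
  refine D.mem_reach.2 ⟨j, D.mem_ball.2 ?_, rfl⟩
  have h : D.graph.Adj i j := by simpa [nbrs] using h
  simpa using (SimpleGraph.edist_eq_one_iff_adj.2 h).le

theorem Lam_apply (i j : Fin n) [Decidable (D.reach i ∩ D.reach j).Nonempty] :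
    D.Lam i j = if (D.reach i ∩ D.reach j).Nonempty then 1 else 0 := by
  simp only [Lam, Matrix.of_apply]
  congr

theorem Lam_eq_zero_or_one (i j : Fin n) : D.Lam i j = 0 ∨ D.Lam i j = 1 := by
  classical
  rw [Lam_apply]
  split_ifs <;> simp

theorem Lam_symm (i j : Fin n) : D.Lam i j = D.Lam j i := by
  classical
  simp only [Lam_apply, Finset.inter_comm]

theorem disjoint_reach_of_Lam_eq_zero {i j : Fin n} (h : D.Lam i j = 0) :
    Disjoint (D.reach i) (D.reach j) := by
  classical
  rw [Lam_apply] at h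
  rw [Finset.disjoint_iff_inter_eq_empty, ← Finset.not_nonempty_iff_eq_empty]
  intro h'
  simp [h'] at h

theorem card_depSet (i : Fin n) : ((D.depSet i).card : ℝ) = ∑ j, D.Lam i j := by
  classical
  rw [depSet, Finset.card_filter]
  push_cast
  refine Finset.sum_congr rfl fun j _ => ?_
  rcases D.Lam_eq_zero_or_one i j with h | h <;> simp [h]

/-- A walk of length at most two has a vertex within distance one of both ends, and the cluster of
that vertex meets both neighbourhoods. Hence `Λ = 0` forces distance more than two, as the local
dependence of the errors requires. -/
theorem Lam_eq_one_of_mem_ball_two {i j : Fin n} (h : j ∈ D.ball i 2) : D.Lam i j = 1 := by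
  classical
  have hd := D.mem_ball.1 h
  obtain ⟨m, h1, h2⟩ : ∃ m, m ∈ D.ball i 1 ∧ m ∈ D.ball j 1 := by
    obtain ⟨p, hp⟩ := SimpleGraph.exists_walk_of_edist_ne_top
      (ne_top_of_le_ne_top (by simp) hd)
    rw [← hp] at hd
    have hl : p.length ≤ 2 := by exact_mod_cast hd
    simp only [mem_ball]
    cases p with
    | nil => exact ⟨i, by simp⟩
    | cons a q =>
      rename_i m
      refine ⟨m, by simpa using (SimpleGraph.edist_eq_one_iff_adj.2 a).le, ?_⟩
      rw [SimpleGraph.edist_comm]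
      refine q.edist_le.trans ?_
      simp only [SimpleGraph.Walk.length_cons] at hl
      exact_mod_cast (by omega : q.length ≤ 1)
  rw [Lam_apply, if_pos]
  exact ⟨D.e m, Finset.mem_inter.2 ⟨D.mem_reach.2 ⟨m, h1, rfl⟩, D.mem_reach.2 ⟨m, h2, rfl⟩⟩⟩

variable {Ω : Type*} [MeasurableSpace Ω] {P : Measure Ω} {t : Fin D.K → Ω → Bool}
  {ε : Fin n → Ω → ℝ}

/-- Every cluster contains its ego, so the unit treatments determine the cluster treatments: read
`T` at `ego k`. -/
theorem indepFun_error_treatment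
    (hi : IndepFun (fun ω i => ε i ω) (fun ω => D.treat fun k => t k ω) P) :
    IndepFun (fun ω i => ε i ω) (fun ω k => t k ω) P := by
  classical
  have hψ : Measurable fun (T : Fin n → ℝ) (k : Fin D.K) => decide (T (D.ego k) = 1) := by
    refine measurable_pi_lambda _ fun k => ?_
    refine measurable_to_bool ?_
    have : (fun T : Fin n → ℝ => decide (T (D.ego k) = 1)) ⁻¹' {true} =
        (fun T : Fin n → ℝ => T (D.ego k)) ⁻¹' {1} := by
      ext T; simp
    rw [this]
    exact measurable_pi_apply _ (measurableSet_singleton _)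
  have e : (fun ω k => t k ω) = (fun (T : Fin n → ℝ) (k : Fin D.K) => decide (T (D.ego k) = 1)) ∘
      fun ω => D.treat fun k => t k ω := by
    ext ω k
    simp [treat, D.e_ego]
  rw [e]
  exact hi.comp measurable_id hψ

/-- Families of functions of the local treatments and the own error have `Λ` as a dependency
matrix. -/
theorem isDependencyMatrix_Lam [IsProbabilityMeasure P] (ht : ∀ k, Measurable (t k))
    (hti : iIndepFun t P) (hε : ∀ i, Measurable (ε i))
    (hloc : ∀ I J : Finset (Fin n), (∀ i ∈ I, ∀ j ∈ J, j ∉ D.ball i 2) →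
      IndepFun (fun ω (i : I) => ε i ω) (fun ω (j : J) => ε j ω) P)
    (hi : IndepFun (fun ω i => ε i ω) (fun ω => D.treat fun k => t k ω) P)
    (F : Fin n → (Fin D.K → Bool) → ℝ → ℝ) (hF : ∀ i a, Measurable (F i a))
    (hFloc : ∀ i a a', (∀ k ∈ D.reach i, a k = a' k) → F i a = F i a') :
    IsDependencyMatrix P (fun i j => D.Lam i j) (fun i ω => F i (fun k => t k ω) (ε i ω)) where
  zero_or_one := D.Lam_eq_zero_or_one
  symm := D.Lam_symm
  indep I J hIJ := by
    classical
    set A := I.biUnion D.reach with hA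
    set B := J.biUnion D.reach with hB
    have hAB : Disjoint A B := by
      rw [hA, hB, Finset.disjoint_biUnion_left]
      intro i hi
      rw [Finset.disjoint_biUnion_right]
      exact fun j hj => D.disjoint_reach_of_Lam_eq_zero (hIJ i hi j hj)
    have hεIJ := hloc I J fun i hi j hj hb => by
      have := D.Lam_eq_one_of_mem_ball_two hb
      rw [hIJ i hi j hj] at this
      exact zero_ne_one this
    have htAB := hti.indepFun_finset A B hAB ht
    have hεt := (D.indepFun_error_treatment hi).comp
      (φ := fun x : Fin n → ℝ => ((fun i : I => x i), (fun j : J => x j)))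
      (ψ := fun a : Fin D.K → Bool => ((fun k : A => a k), (fun k : B => a k)))
      (by fun_prop) (by fun_prop)
    have h4 := IndepFun.prodMk_prodMk_of_prodMk (f := fun ω (i : I) => ε i ω)
      (f' := fun ω (j : J) => ε j ω) (g := fun ω (k : A) => t k ω) (g' := fun ω (k : B) => t k ω)
      (by fun_prop) (by fun_prop) (by fun_prop) (by fun_prop) hεIJ htAB hεt
    -- Assignments on `S` are padded with `false`. The value is irrelevant, because `F i` sees only
    -- the clusters in `D.reach i`, which lie in `S`.
    let ext : (S : Finset (Fin D.K)) → (S → Bool) → Fin D.K → Bool :=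
      fun S a k => if h : k ∈ S then a ⟨k, h⟩ else false
    have hG : ∀ (I : Finset (Fin n)) (S : Finset (Fin D.K)),
        Measurable fun (p : (I → ℝ) × (S → Bool)) (i : I) => F i (ext S p.2) (p.1 i) :=
      fun I S => measurable_pi_lambda _ fun i => measurable_from_prod_countable_left fun a =>
        (hF i (ext S a)).comp (measurable_pi_apply i)
    have hext : ∀ (I : Finset (Fin n)) ω (i : I),
        F i (ext (I.biUnion D.reach) fun k => t k ω) = F i fun k => t k ω := fun I ω i => by
      refine hFloc _ _ _ fun k hk => ?_
      have : k ∈ I.biUnion D.reach := Finset.mem_biUnion.2 ⟨i, i.2, hk⟩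
      simp only [ext]
      rw [dif_pos this]
    have := h4.comp (hG I A) (hG J B)
    convert this using 1
    · ext ω i
      simp only [Function.comp]
      rw [hA, hext]
    · ext ω j
      simp only [Function.comp]
      rw [hB, hext]

end EgoDesign

end

/-! ### Perturbation of a 3 × 3 linear system -/

section Perturbation

variable {A M Q : Matrix (Fin 3) (Fin 3) ℝ} {q d : ℝ}

theorem abs_mulVec_le_of_abs_le {B : Matrix (Fin 3) (Fin 3) ℝ} {v : Fin 3 → ℝ} {x y : ℝ}
    (hB : ∀ a b, |B a b| ≤ x) (hv : ∀ a, |v a| ≤ y) (a : Fin 3) :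
    |B.mulVec v a| ≤ 3 * (x * y) := by
  rw [Matrix.mulVec, dotProduct]
  calc |∑ b, B a b * v b| ≤ ∑ b, |B a b * v b| := Finset.abs_sum_le_sum_abs _ _
    _ ≤ ∑ _b : Fin 3, x * y := Finset.sum_le_sum fun b _ => by
        rw [abs_mul]
        exact mul_le_mul (hB a b) (hv b) (abs_nonneg _) ((abs_nonneg _).trans (hB a b))
    _ = 3 * (x * y) := by simp

/-- In the application `A` is the Gram matrix, `M` its mean and `Q` the inverse of the mean. Only
`M` is inverted, so invertibility of `A` can be deduced from this identity. -/
theorem sub_mulVec_eq_of_left_inverse (hQM : Q * M = 1) (v : Fin 3 → ℝ) :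
    v - Q.mulVec (A.mulVec v) = - Q.mulVec ((A - M).mulVec v) := by
  rw [Matrix.sub_mulVec, Matrix.mulVec_sub, Matrix.mulVec_mulVec v Q M, hQM, Matrix.one_mulVec]
  abel

/-- In the sup norm the identity yields `‖v‖ ≤ 3qy + 9qd‖v‖`, each factor `3` coming from a row sum.
As `18qd ≤ 1`, the last term is at most `‖v‖ / 2` and is absorbed. -/
theorem abs_le_of_left_inverse (hQM : Q * M = 1) (hQ : ∀ a b, |Q a b| ≤ q)
    (hA : ∀ a b, |(A - M) a b| ≤ d) (hqd : 18 * (q * d) ≤ 1) (v : Fin 3 → ℝ) {y : ℝ}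
    (hv : ∀ a, |A.mulVec v a| ≤ y) (a : Fin 3) : |v a| ≤ 6 * (q * y) := by
  have h1 : ∀ a, |v a| ≤ ‖v‖ := fun a => by
    simpa using norm_le_pi_norm v a
  have h2 : ∀ a, |v a| ≤ 3 * (q * y) + 3 * (q * (3 * (d * ‖v‖))) := fun a => by
    have := congrFun (sub_mulVec_eq_of_left_inverse (A := A) hQM v) a
    simp only [Pi.sub_apply, Pi.neg_apply] at this
    have e : v a = Q.mulVec (A.mulVec v) a + -(Q.mulVec ((A - M).mulVec v) a) := by
      rw [← this]; ring
    rw [e]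
    refine (abs_add_le _ _).trans (add_le_add (abs_mulVec_le_of_abs_le hQ hv a) ?_)
    rw [abs_neg]
    exact abs_mulVec_le_of_abs_le hQ (abs_mulVec_le_of_abs_le hA h1) a
  have h3 : ‖v‖ ≤ 3 * (q * y) + 3 * (q * (3 * (d * ‖v‖))) :=
    (pi_norm_le_iff_of_nonneg ((abs_nonneg _).trans (h2 0))).2 fun a => by simpa using h2 a
  have := mul_le_mul_of_nonneg_right hqd (norm_nonneg v)
  refine (h1 a).trans ?_
  nlinarith

theorem det_ne_zero_of_left_inverse (hQM : Q * M = 1) (hQ : ∀ a b, |Q a b| ≤ q)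
    (hA : ∀ a b, |(A - M) a b| ≤ d) (hqd : 18 * (q * d) ≤ 1) : A.det ≠ 0 := by
  intro h
  obtain ⟨v, hv0, hv⟩ := Matrix.exists_mulVec_eq_zero_iff.2 h
  refine hv0 (funext fun a => ?_)
  have := abs_le_of_left_inverse hQM hQ hA hqd v (y := 0) (by simp [hv]) a
  simpa using this

/-- Inserting the a priori bound `6qy` into the identity gives `3q · 3d · 6qy`. -/
theorem abs_sub_mulVec_le_of_left_inverse (hQM : Q * M = 1) (hQ : ∀ a b, |Q a b| ≤ q)
    (hA : ∀ a b, |(A - M) a b| ≤ d) (hqd : 18 * (q * d) ≤ 1) (v : Fin 3 → ℝ) {y : ℝ}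
    (hv : ∀ a, |A.mulVec v a| ≤ y) (a : Fin 3) :
    |v a - Q.mulVec (A.mulVec v) a| ≤ 54 * q ^ 2 * (d * y) := by
  have := congrFun (sub_mulVec_eq_of_left_inverse (A := A) hQM v) a
  simp only [Pi.sub_apply, Pi.neg_apply] at this
  rw [this, abs_neg]
  refine (abs_mulVec_le_of_abs_le hQ (abs_mulVec_le_of_abs_le hA
    (abs_le_of_left_inverse hQM hQ hA hqd v hv)) a).trans_eq ?_
  ring

end Perturbation

/-! ### Linearisation of the least squares estimator -/

noncomputable section

namespace EgoDesign

variable {n : ℕ} (D : EgoDesign n)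

/-- The expectation of `XᵀX / n`. -/
def meanGram : Matrix (Fin 3) (Fin 3) ℝ :=
  !![1, 1 / 2, 1 / 2; 1 / 2, 1 / 2, (1 + (1 - D.meanLoss)) / 4;
    1 / 2, (1 + (1 - D.meanLoss)) / 4, (1 + (D.b + (1 - D.meanLoss) ^ 2)) / 4]

/-- The inverse of the expectation of `XᵀX / n`. -/
def meanGramInv : Matrix (Fin 3) (Fin 3) ℝ :=
  !![2 + 1 / D.b * D.meanLoss ^ 2, -2 + 2 / D.b * D.meanLoss * (1 - D.meanLoss),
      -(2 / D.b * D.meanLoss);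
    -2 + 2 / D.b * D.meanLoss * (1 - D.meanLoss), 4 + 4 / D.b * (1 - D.meanLoss) ^ 2,
      -(4 / D.b * (1 - D.meanLoss));
    -(2 / D.b * D.meanLoss), -(4 / D.b * (1 - D.meanLoss)), 4 / D.b]

/-- The Schur complement of the upper 2 × 2 block of `meanGram` is `b / 4`, so `b ≠ 0` is the only
condition needed. -/
theorem meanGramInv_mul_meanGram (hb : D.b ≠ 0) : D.meanGramInv * D.meanGram = 1 := by
  ext i j
  fin_cases i <;> fin_cases j <;>
    simp [meanGramInv, meanGram, Matrix.mul_apply, Fin.sum_univ_three] <;> field_simp <;> ring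

theorem abs_meanGramInv_le {c₀ : ℝ} (hc : 0 < c₀) (hb : c₀ ≤ D.b) (hr0 : 0 ≤ D.meanLoss)
    (hr1 : D.meanLoss ≤ 1) (i j : Fin 3) : |D.meanGramInv i j| ≤ 4 + 4 / c₀ := by
  set r := D.meanLoss
  have hb0 : 0 < D.b := hc.trans_le hb
  have hx : 0 < 1 / D.b := by positivity
  have hx' : 1 / D.b ≤ 1 / c₀ := one_div_le_one_div_of_le hc hb
  have key : ∀ u w : ℝ, |u| ≤ 4 → |w| ≤ 4 → |u + 1 / D.b * w| ≤ 4 + 4 / c₀ := fun u w hu hw => by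
    refine (abs_add_le _ _).trans (add_le_add hu ?_)
    rw [abs_mul, abs_of_pos hx]
    calc 1 / D.b * |w| ≤ 1 / c₀ * 4 := by gcongr
      _ = 4 / c₀ := by ring
  have h1 : |r ^ 2| ≤ 4 := abs_le.2 ⟨by nlinarith, by nlinarith⟩
  have h2 : |2 * r * (1 - r)| ≤ 4 := abs_le.2 ⟨by nlinarith, by nlinarith⟩
  have h3 : |-(2 * r)| ≤ 4 := abs_le.2 ⟨by nlinarith, by nlinarith⟩
  have h4 : |4 * (1 - r) ^ 2| ≤ 4 := abs_le.2 ⟨by nlinarith, by nlinarith⟩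
  have h5 : |-(4 * (1 - r))| ≤ 4 := abs_le.2 ⟨by nlinarith, by nlinarith⟩
  have n0 : |(0 : ℝ)| ≤ 4 := by norm_num
  have n2 : |(2 : ℝ)| ≤ 4 := by norm_num
  have n2' : |(-2 : ℝ)| ≤ 4 := by norm_num
  have n4 : |(4 : ℝ)| ≤ 4 := by norm_num
  have k1 := key 2 _ n2 h1
  have k2 := key (-2) _ n2' h2
  have k3 := key 0 _ n0 h3
  have k4 := key 4 _ n4 h4
  have k5 := key 0 _ n0 h5
  have k6 := key 0 _ n0 n4
  have e2 : -2 + 1 / D.b * (2 * r * (1 - r)) = -2 + 2 / D.b * r * (1 - r) := by ring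
  have e3 : 0 + 1 / D.b * -(2 * r) = -(2 / D.b * r) := by ring
  have e4 : 4 + 1 / D.b * (4 * (1 - r) ^ 2) = 4 + 4 / D.b * (1 - r) ^ 2 := by ring
  have e5 : 0 + 1 / D.b * -(4 * (1 - r)) = -(4 / D.b * (1 - r)) := by ring
  have e6 : 0 + 1 / D.b * 4 = 4 / D.b := by ring
  rw [e2] at k2
  rw [e3] at k3
  rw [e4] at k4
  rw [e5] at k5
  rw [e6] at k6
  fin_cases i <;> fin_cases j <;> assumption

/-- The normalized score `Xᵀε / √n`. -/
def score (T ε : Fin n → ℝ) (a : Fin 3) : ℝ := (∑ i, D.designMatrix T i a * ε i) / Real.sqrt n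

/-- The second moment matrix `XᵀX / n` of the regressors. -/
def gram (T : Fin n → ℝ) : Matrix (Fin 3) (Fin 3) ℝ :=
  Matrix.of fun a b => (∑ i, D.designMatrix T i a * D.designMatrix T i b) / n

/-- Controls the remainder of the linear approximation of the least squares estimator. -/
def olsError (T ε : Fin n → ℝ) : ℝ :=
  Real.sqrt n * ∑ a, ∑ b, (D.gram T a b - D.meanGram a b) ^ 2
    + (∑ a, D.score T ε a ^ 2) / Real.sqrt n

theorem meanGramInv_mulVec_score_two (T ε : Fin n → ℝ) :
    D.meanGramInv.mulVec (D.score T ε) 2 = (∑ i, D.Wgamma T i * ε i) / Real.sqrt n := by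
  simp only [Matrix.mulVec, dotProduct, Fin.sum_univ_three, score, mul_div_assoc', ← add_div,
    Finset.mul_sum, ← Finset.sum_add_distrib]
  congr 1
  refine Finset.sum_congr rfl fun i _ => ?_
  simp [meanGramInv, designMatrix, Wgamma]
  ring

theorem meanGramInv_mulVec_score_one (T ε : Fin n → ℝ) :
    D.meanGramInv.mulVec (D.score T ε) 1 + D.meanGramInv.mulVec (D.score T ε) 2
      = (∑ i, D.Wtau T i * ε i) / Real.sqrt n := by
  rw [meanGramInv_mulVec_score_two]
  simp only [Matrix.mulVec, dotProduct, Fin.sum_univ_three, score, mul_div_assoc', ← add_div,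
    Finset.mul_sum, ← Finset.sum_add_distrib]
  congr 1
  refine Finset.sum_congr rfl fun i _ => ?_
  simp [meanGramInv, designMatrix, Wgamma, Wtau]
  ring

theorem gram_mulVec_ols_sub (hn : 0 < n) (α β γ : ℝ) (T ε : Fin n → ℝ)
    (hdet : (D.gram T).det ≠ 0) :
    (D.gram T).mulVec (Real.sqrt n • (D.ols T (D.outcome α β γ T ε) - ![α, β, γ]))
      = D.score T ε := by
  have hn' : (0 : ℝ) < n := by exact_mod_cast hn
  set X := D.designMatrix T with hX
  have hgram : D.gram T = (n : ℝ)⁻¹ • (X.transpose * X) := by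
    ext a b
    simp [gram, Matrix.mul_apply, hX, div_eq_inv_mul]
  have hA : IsUnit (X.transpose * X).det := by
    rw [isUnit_iff_ne_zero]
    intro h
    rw [hgram, Matrix.det_smul, h, mul_zero] at hdet
    exact hdet rfl
  have hY : D.outcome α β γ T ε = X.mulVec ![α, β, γ] + ε := by
    ext i
    simp [outcome, hX, designMatrix]
    ring
  have hols : D.ols T (D.outcome α β γ T ε) - ![α, β, γ]
      = (X.transpose * X)⁻¹.mulVec (X.transpose.mulVec ε) := by
    rw [ols, ← hX, hY, Matrix.mulVec_add, Matrix.mulVec_mulVec, Matrix.mul_assoc,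
      Matrix.nonsing_inv_mul _ hA, Matrix.one_mulVec, Matrix.mulVec_mulVec]
    abel
  rw [hols, hgram, Matrix.smul_mulVec, Matrix.mulVec_smul, Matrix.mulVec_mulVec,
    Matrix.mul_nonsing_inv _ hA, Matrix.one_mulVec]
  ext a
  have hs : (n : ℝ)⁻¹ * Real.sqrt n = (Real.sqrt n)⁻¹ := by
    rw [inv_mul_eq_div, Real.sqrt_div_self]
  simp only [score, Pi.smul_apply, smul_eq_mul, ← mul_assoc, hs, Matrix.mulVec, dotProduct,
    Matrix.transpose_apply, div_eq_inv_mul, hX]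

/-- The linear approximation of the least squares estimator. -/
theorem abs_ols_sub_le (hn : 0 < n) (α β γ : ℝ) (T ε : Fin n → ℝ) {q : ℝ} (hq : 0 < q)
    (hb : D.b ≠ 0) (hQ : ∀ a b, |D.meanGramInv a b| ≤ q)
    (hZ : D.olsError T ε ≤ (1 / (18 * q)) ^ 2) (a : Fin 3) :
    |Real.sqrt n * (D.ols T (D.outcome α β γ T ε) a - ![α, β, γ] a)
        - D.meanGramInv.mulVec (D.score T ε) a| ≤ 27 * q ^ 2 * D.olsError T ε := by
  have hn1 : (1 : ℝ) ≤ n := by exact_mod_cast hn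
  have hs1 : 1 ≤ Real.sqrt n := by rwa [Real.one_le_sqrt]
  have hs0 : 0 < Real.sqrt n := by linarith
  set d2 := ∑ a, ∑ b, (D.gram T a b - D.meanGram a b) ^ 2 with hd2
  set B2 := ∑ a, D.score T ε a ^ 2 with hB2
  have hd20 : 0 ≤ d2 := Finset.sum_nonneg fun a _ => Finset.sum_nonneg fun b _ => sq_nonneg _
  have hB20 : 0 ≤ B2 := Finset.sum_nonneg fun a _ => sq_nonneg _
  have hZdef : D.olsError T ε = Real.sqrt n * d2 + B2 / Real.sqrt n := rfl
  have hB2s : 0 ≤ B2 / Real.sqrt n := by positivity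
  have hdZ : d2 ≤ D.olsError T ε := by rw [hZdef]; nlinarith
  have hA : ∀ a b, |(D.gram T - D.meanGram) a b| ≤ Real.sqrt d2 := fun a b => by
    refine Real.abs_le_sqrt ?_
    rw [hd2, Matrix.sub_apply]
    refine le_trans ?_ (Finset.single_le_sum (f := fun a => ∑ b, (D.gram T a b
      - D.meanGram a b) ^ 2) (fun a _ => Finset.sum_nonneg fun b _ => sq_nonneg _)
      (Finset.mem_univ a))
    exact Finset.single_le_sum (f := fun b => (D.gram T a b - D.meanGram a b) ^ 2)
      (fun b _ => sq_nonneg _) (Finset.mem_univ b)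
  have hB : ∀ a, |D.score T ε a| ≤ Real.sqrt B2 := fun a => by
    refine Real.abs_le_sqrt ?_
    exact Finset.single_le_sum (f := fun a => D.score T ε a ^ 2)
      (fun b _ => sq_nonneg _) (Finset.mem_univ a)
  -- Since `√n ≥ 1`, the squared Gram deviation `d2` is at most `olsError`; the threshold `(1 /
  -- (18q))²` is what the perturbation lemmas need, and it also makes the Gram matrix invertible.
  have hqd : 18 * (q * Real.sqrt d2) ≤ 1 := by
    have : Real.sqrt d2 ≤ 1 / (18 * q) :=
      Real.sqrt_le_iff.2 ⟨by positivity, hdZ.trans hZ⟩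
    calc 18 * (q * Real.sqrt d2) ≤ 18 * (q * (1 / (18 * q))) := by gcongr
      _ = 1 := by field_simp
  have hQM := D.meanGramInv_mul_meanGram hb
  have hv := D.gram_mulVec_ols_sub hn α β γ T ε (det_ne_zero_of_left_inverse hQM hQ hA hqd)
  have key := abs_sub_mulVec_le_of_left_inverse hQM hQ hA hqd
    (Real.sqrt n • (D.ols T (D.outcome α β γ T ε) - ![α, β, γ])) (y := Real.sqrt B2)
    (by rw [hv]; exact hB) a
  rw [hv] at key
  refine key.trans ?_
  -- The weights `√n` and `1 / √n` in `olsError` are balanced for this inequality of arithmetic and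
  -- geometric means; it turns the constant `54` into `27`.
  have ham : Real.sqrt d2 * Real.sqrt B2 ≤ D.olsError T ε / 2 := by
    rw [hZdef]
    set x := Real.sqrt d2
    set y := Real.sqrt B2
    set s := Real.sqrt n
    have hx : x ^ 2 = d2 := Real.sq_sqrt hd20
    have hy : y ^ 2 = B2 := Real.sq_sqrt hB20
    rw [← hx, ← hy]
    have : 0 ≤ (s * x - y) ^ 2 / s := by positivity
    have e : (s * x - y) ^ 2 / s = s * x ^ 2 + y ^ 2 / s - 2 * (x * y) := by
      field_simp
      ring
    rw [e] at this
    linarith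
  nlinarith [sq_nonneg q]

end EgoDesign

end

/-! ### Moments of the regressors under cluster randomization -/

noncomputable section

namespace EgoDesign

variable {n : ℕ} (D : EgoDesign n)

theorem R_nonneg (i : Fin n) (k : Fin D.K) : 0 ≤ D.R i k := by
  unfold R; positivity

theorem sum_R (i : Fin n) (hd : 0 < D.deg i) : ∑ k, D.R i k = 1 := by
  have hd' : (0 : ℝ) < D.deg i := by exact_mod_cast hd
  simp only [R]
  rw [← Finset.sum_div, div_eq_one_iff_eq hd'.ne']
  norm_cast
  rw [deg, Finset.card_eq_sum_card_fiberwise (f := D.e) (t := Finset.univ) (by simp)]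
  refine Finset.sum_congr rfl fun k _ => congrArg _ ?_
  ext j
  simp [cluster]

/-- Grouping neighbours by cluster exhibits `ρ_i` as a weighted sum of the cluster treatments, which
are independent in the design. -/
theorem rho_treat (a : Fin D.K → Bool) (i : Fin n) :
    D.rho (D.treat a) i = ∑ k, D.R i k * (if a k then 1 else 0) := by
  simp only [R, div_mul_eq_mul_div]
  rw [← Finset.sum_div, rho]
  congr 1
  rw [← Finset.sum_fiberwise_of_maps_to (s := D.nbrs i) (t := Finset.univ) (g := D.e) (by simp)]
  refine Finset.sum_congr rfl fun k _ => ?_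
  have : D.nbrs i ∩ D.cluster k = (D.nbrs i).filter fun j => D.e j = k := by
    ext j; simp [cluster]
  rw [this, Finset.sum_congr rfl (g := fun _ => if a k then (1 : ℝ) else 0)]
  · simp
  · intro j hj
    simp only [treat, (Finset.mem_filter.1 hj).2]

theorem treat_nonneg (a : Fin D.K → Bool) (i : Fin n) : 0 ≤ D.treat a i := by
  unfold treat; split_ifs <;> norm_num

theorem treat_le_one (a : Fin D.K → Bool) (i : Fin n) : D.treat a i ≤ 1 := by
  unfold treat; split_ifs <;> norm_num

theorem rho_treat_nonneg (a : Fin D.K → Bool) (i : Fin n) : 0 ≤ D.rho (D.treat a) i :=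
  div_nonneg (Finset.sum_nonneg fun j _ => D.treat_nonneg a j) (Nat.cast_nonneg _)

theorem rho_treat_le_one (a : Fin D.K → Bool) (i : Fin n) : D.rho (D.treat a) i ≤ 1 := by
  refine div_le_one_of_le₀ ?_ (Nat.cast_nonneg _)
  calc ∑ j ∈ D.nbrs i, D.treat a j ≤ ∑ j ∈ D.nbrs i, 1 :=
        Finset.sum_le_sum fun j _ => D.treat_le_one a j
    _ = D.deg i := by simp [deg]

theorem abs_designMatrix_le (a : Fin D.K → Bool) (i : Fin n) (c : Fin 3) :
    |D.designMatrix (D.treat a) i c| ≤ 1 := by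
  have h1 := D.treat_nonneg a i
  have h2 := D.treat_le_one a i
  have h3 := D.rho_treat_nonneg a i
  have h4 := D.rho_treat_le_one a i
  fin_cases c
  · simp [designMatrix]
  · simpa [designMatrix, abs_of_nonneg h1] using h2
  · simpa [designMatrix, abs_of_nonneg h3] using h4

theorem treat_congr {a a' : Fin D.K → Bool} {i : Fin n} (h : ∀ k ∈ D.reach i, a k = a' k) :
    D.treat a i = D.treat a' i := by
  simp only [treat, h _ (D.e_mem_reach i)]

theorem rho_treat_congr {a a' : Fin D.K → Bool} {i : Fin n} (h : ∀ k ∈ D.reach i, a k = a' k) :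
    D.rho (D.treat a) i = D.rho (D.treat a') i := by
  simp only [rho]
  congr 1
  refine Finset.sum_congr rfl fun j hj => ?_
  simp only [treat, h _ (D.e_mem_reach_of_mem_nbrs hj)]

theorem designMatrix_congr {a a' : Fin D.K → Bool} {i : Fin n}
    (h : ∀ k ∈ D.reach i, a k = a' k) :
    D.designMatrix (D.treat a) i = D.designMatrix (D.treat a') i := by
  ext c
  fin_cases c <;> simp [designMatrix, D.treat_congr h, D.rho_treat_congr h]

theorem R_le_one (i : Fin n) (k : Fin D.K) : D.R i k ≤ 1 := by
  refine div_le_one_of_le₀ ?_ (Nat.cast_nonneg _)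
  exact_mod_cast Finset.card_le_card Finset.inter_subset_left

theorem meanLoss_nonneg : 0 ≤ D.meanLoss :=
  div_nonneg (Finset.sum_nonneg fun i _ => sub_nonneg.2 (D.R_le_one i _)) (Nat.cast_nonneg _)

theorem meanLoss_le_one : D.meanLoss ≤ 1 := by
  refine div_le_one_of_le₀ ?_ (Nat.cast_nonneg _)
  calc ∑ i, D.lossRate i ≤ ∑ _i : Fin n, 1 :=
        Finset.sum_le_sum fun i _ => by
          have := D.R_nonneg i (D.e i)
          simp only [lossRate]
          linarith
    _ = n := by simp

theorem max_le_b : max D.crossTerm D.lossVar ≤ D.b := by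
  have h1 : 0 ≤ D.crossTerm := div_nonneg (Finset.sum_nonneg fun i _ =>
    Finset.sum_nonneg fun k _ => sq_nonneg _) (Nat.cast_nonneg _)
  have h2 : 0 ≤ D.lossVar := div_nonneg (Finset.sum_nonneg fun i _ => sq_nonneg _)
    (Nat.cast_nonneg _)
  simp only [b]
  exact max_le (by linarith) (by linarith)

theorem abs_Wgamma_le {c₀ : ℝ} (hc : 0 < c₀) (hb : c₀ ≤ D.b) (a : Fin D.K → Bool) (i : Fin n) :
    |D.Wgamma (D.treat a) i| ≤ 4 / c₀ := by
  have h1 := D.treat_nonneg a i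
  have h2 := D.treat_le_one a i
  have h3 := D.rho_treat_nonneg a i
  have h4 := D.rho_treat_le_one a i
  have h5 := D.meanLoss_nonneg
  have h6 := D.meanLoss_le_one
  have hb0 : 0 < D.b := hc.trans_le hb
  rw [Wgamma, abs_mul, abs_of_pos (by positivity : 0 < 4 / D.b)]
  calc 4 / D.b * _ ≤ 4 / c₀ * 1 := by
        gcongr
        rw [abs_le]
        constructor <;> nlinarith
    _ = _ := by ring

theorem abs_Wtau_le {c₀ : ℝ} (hc : 0 < c₀) (hb : c₀ ≤ D.b) (a : Fin D.K → Bool) (i : Fin n) :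
    |D.Wtau (D.treat a) i| ≤ 4 + 4 / c₀ := by
  have h1 := D.treat_nonneg a i
  have h2 := D.treat_le_one a i
  have h5 := D.meanLoss_nonneg
  have h6 := D.meanLoss_le_one
  refine (abs_add_le _ _).trans (add_le_add ?_ ?_)
  · rw [abs_le]
    constructor <;> linarith
  · rw [abs_mul, abs_of_nonneg h5]
    calc D.meanLoss * _ ≤ 1 * (4 / c₀) :=
          mul_le_mul h6 (D.abs_Wgamma_le hc hb a i) (abs_nonneg _) zero_le_one
      _ = _ := by ring

theorem Wgamma_congr {a a' : Fin D.K → Bool} {i : Fin n} (h : ∀ k ∈ D.reach i, a k = a' k) :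
    D.Wgamma (D.treat a) i = D.Wgamma (D.treat a') i := by
  simp only [Wgamma, D.treat_congr h, D.rho_treat_congr h]

theorem Wtau_congr {a a' : Fin D.K → Bool} {i : Fin n} (h : ∀ k ∈ D.reach i, a k = a' k) :
    D.Wtau (D.treat a) i = D.Wtau (D.treat a') i := by
  simp only [Wtau, D.treat_congr h, D.Wgamma_congr h]

/-- The own-cluster term is `(1 - r_i)²`, whose average is its variance `lossVar` plus the squared
mean. This is how `b` enters the second moment of `ρ`. -/
theorem sum_sum_R_sq_div (hn : 0 < n) :
    (∑ i, ∑ k, D.R i k ^ 2) / n = D.b + (1 - D.meanLoss) ^ 2 := by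
  have hn' : (n : ℝ) ≠ 0 := by exact_mod_cast hn.ne'
  have h1 : ∀ i, ∑ k, D.R i k ^ 2
      = ∑ k ∈ Finset.univ.erase (D.e i), D.R i k ^ 2 + (1 - D.lossRate i) ^ 2 := fun i => by
    rw [← Finset.sum_erase_add _ _ (Finset.mem_univ (D.e i)), lossRate]
    ring
  have h2 : (∑ i, (1 - D.lossRate i) ^ 2) / n = D.lossVar + (1 - D.meanLoss) ^ 2 := by
    have hs : ∑ i, D.lossRate i = n * D.meanLoss := by rw [meanLoss]; field_simp
    have : ∀ i, (1 - D.lossRate i) ^ 2 = (D.lossRate i - D.meanLoss) ^ 2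
        + (2 * (D.meanLoss - 1) * D.lossRate i + (1 - D.meanLoss ^ 2)) := fun i => by ring
    simp_rw [this]
    rw [Finset.sum_add_distrib, Finset.sum_add_distrib, ← Finset.mul_sum, hs, add_div, lossVar]
    simp
    field_simp
    ring
  simp_rw [h1]
  rw [Finset.sum_add_distrib, add_div, h2, b, crossTerm]
  ring

variable {Ω : Type*} [MeasurableSpace Ω] {P : Measure Ω} {t : Fin D.K → Ω → Bool}

theorem measurable_comp_treatment (ht : ∀ k, Measurable (t k)) {E : Type*} [MeasurableSpace E]
    (f : (Fin D.K → Bool) → E) : Measurable fun ω => f fun k => t k ω :=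
  (measurable_of_finite f).comp (measurable_pi_lambda _ ht)

theorem integral_bernoulli {t : Ω → Bool} (ht : Measurable t) (hb : P {ω | t ω = true} = 1 / 2) :
    ∫ ω, (if t ω then (1 : ℝ) else 0) ∂P = 1 / 2 := by
  have hs : MeasurableSet {ω | t ω = true} := ht (measurableSet_singleton true)
  have : (fun ω => if t ω then (1 : ℝ) else 0) = Set.indicator {ω | t ω = true} 1 := by
    ext ω
    by_cases h : t ω = true <;> simp [h]
  rw [this, integral_indicator_one hs, measureReal_def, hb]
  simp

theorem integral_bernoulli_mul (ht : ∀ k, Measurable (t k)) (hti : iIndepFun t P)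
    (hb : ∀ k, P {ω | t k ω = true} = 1 / 2) (k l : Fin D.K) :
    ∫ ω, (if t k ω then (1 : ℝ) else 0) * (if t l ω then (1 : ℝ) else 0) ∂P
      = 1 / 4 + if k = l then 1 / 4 else 0 := by
  by_cases hkl : k = l
  · subst hkl
    have : ∀ ω, (if t k ω then (1 : ℝ) else 0) * (if t k ω then (1 : ℝ) else 0)
        = if t k ω then (1 : ℝ) else 0 := fun ω => by split_ifs <;> simp
    simp_rw [this]
    rw [integral_bernoulli (ht k) (hb k)]
    norm_num
  · have hm : Measurable fun x : Bool => if x then (1 : ℝ) else 0 := measurable_of_finite _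
    have hind : IndepFun (fun ω => if t k ω then (1 : ℝ) else 0)
        (fun ω => if t l ω then (1 : ℝ) else 0) P := (hti.indepFun hkl).comp hm hm
    rw [hind.integral_fun_mul_eq_mul_integral (hm.comp (ht k)).aestronglyMeasurable
      (hm.comp (ht l)).aestronglyMeasurable, integral_bernoulli (ht k) (hb k),
      integral_bernoulli (ht l) (hb l), if_neg hkl]
    norm_num

theorem integrable_comp_treatment [IsProbabilityMeasure P] (ht : ∀ k, Measurable (t k)) (f : (Fin D.K → Bool) → ℝ) :
    Integrable (fun ω => f fun k => t k ω) P := by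
  obtain ⟨C, hC⟩ := (Set.finite_range fun a => ‖f a‖).bddAbove
  exact Integrable.of_bound (D.measurable_comp_treatment ht f).aestronglyMeasurable C
    (Eventually.of_forall fun ω => hC ⟨_, rfl⟩)

theorem integral_treat (ht : ∀ k, Measurable (t k)) (hb : ∀ k, P {ω | t k ω = true} = 1 / 2)
    (i : Fin n) : ∫ ω, D.treat (fun k => t k ω) i ∂P = 1 / 2 :=
  integral_bernoulli (ht _) (hb _)

theorem integral_treat_mul_treat (ht : ∀ k, Measurable (t k)) (hti : iIndepFun t P)
    (hb : ∀ k, P {ω | t k ω = true} = 1 / 2) (i : Fin n) :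
    ∫ ω, D.treat (fun k => t k ω) i * D.treat (fun k => t k ω) i ∂P = 1 / 2 := by
  refine (D.integral_bernoulli_mul ht hti hb (D.e i) (D.e i)).trans ?_
  norm_num

theorem integral_rho [IsProbabilityMeasure P] (ht : ∀ k, Measurable (t k)) (hb : ∀ k, P {ω | t k ω = true} = 1 / 2)
    {i : Fin n} (hd : 0 < D.deg i) : ∫ ω, D.rho (D.treat fun k => t k ω) i ∂P = 1 / 2 := by
  simp_rw [rho_treat]
  rw [integral_finsetSum _ fun k _ => D.integrable_comp_treatment ht
    fun a => D.R i k * (if a k then 1 else 0)]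
  simp_rw [integral_const_mul, fun k => integral_bernoulli (ht k) (hb k)]
  rw [← Finset.sum_mul, D.sum_R i hd, one_mul]

theorem integral_treat_mul_rho [IsProbabilityMeasure P] (ht : ∀ k, Measurable (t k)) (hti : iIndepFun t P)
    (hb : ∀ k, P {ω | t k ω = true} = 1 / 2) {i : Fin n} (hd : 0 < D.deg i) :
    ∫ ω, D.treat (fun k => t k ω) i * D.rho (D.treat fun k => t k ω) i ∂P
      = (1 + (1 - D.lossRate i)) / 4 := by
  simp_rw [rho_treat, Finset.mul_sum]
  rw [integral_finsetSum _ fun k _ => D.integrable_comp_treatment ht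
    fun a => D.treat a i * (D.R i k * (if a k then 1 else 0))]
  have : ∀ k, ∫ ω, D.treat (fun k => t k ω) i * (D.R i k * (if t k ω then 1 else 0)) ∂P
      = D.R i k * (1 / 4 + if D.e i = k then 1 / 4 else 0) := fun k => by
    rw [← D.integral_bernoulli_mul ht hti hb, ← integral_const_mul]
    congr 1
    ext ω
    simp only [treat]
    ring
  simp_rw [this, mul_add]
  rw [Finset.sum_add_distrib, ← Finset.sum_mul, D.sum_R i hd]
  simp [lossRate]
  ring

theorem integral_rho_mul_rho [IsProbabilityMeasure P] (ht : ∀ k, Measurable (t k)) (hti : iIndepFun t P)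
    (hb : ∀ k, P {ω | t k ω = true} = 1 / 2) {i : Fin n} (hd : 0 < D.deg i) :
    ∫ ω, D.rho (D.treat fun k => t k ω) i * D.rho (D.treat fun k => t k ω) i ∂P
      = (1 + ∑ k, D.R i k ^ 2) / 4 := by
  simp_rw [rho_treat, Finset.sum_mul_sum]
  rw [integral_finsetSum _ fun k _ => D.integrable_comp_treatment ht
    fun a => ∑ l, (D.R i k * (if a k then 1 else 0)) * (D.R i l * (if a l then 1 else 0))]
  have h1 : ∀ k l, ∫ ω, (D.R i k * (if t k ω then 1 else 0)) *
      (D.R i l * (if t l ω then 1 else 0)) ∂P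
      = D.R i k * (D.R i l * (1 / 4 + if k = l then 1 / 4 else 0)) := fun k l => by
    rw [← D.integral_bernoulli_mul ht hti hb, ← integral_const_mul, ← integral_const_mul]
    congr 1
    ext ω
    ring
  have h2 : ∀ k, ∫ ω, ∑ l, (D.R i k * (if t k ω then 1 else 0)) *
      (D.R i l * (if t l ω then 1 else 0)) ∂P
      = D.R i k * (1 / 4) + D.R i k ^ 2 * (1 / 4) := fun k => by
    rw [integral_finsetSum _ fun l _ => D.integrable_comp_treatment ht
      fun a => (D.R i k * (if a k then 1 else 0)) * (D.R i l * (if a l then 1 else 0))]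
    simp_rw [h1, mul_add]
    rw [Finset.sum_add_distrib, ← Finset.mul_sum, ← Finset.sum_mul, D.sum_R i hd]
    simp
    ring
  simp_rw [h2]
  rw [Finset.sum_add_distrib, ← Finset.sum_mul, ← Finset.sum_mul, D.sum_R i hd]
  ring

/-- `meanGram` is the expectation of `XᵀX / n`. -/
theorem sum_integral_designMatrix [IsProbabilityMeasure P] (hn : 0 < n) (hd : ∀ i, 0 < D.deg i)
    (ht : ∀ k, Measurable (t k)) (hti : iIndepFun t P)
    (hb : ∀ k, P {ω | t k ω = true} = 1 / 2) (a b : Fin 3) :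
    ∑ i, ∫ ω, D.designMatrix (D.treat fun k => t k ω) i a
      * D.designMatrix (D.treat fun k => t k ω) i b ∂P = n * D.meanGram a b := by
  have hn' : (n : ℝ) ≠ 0 := by exact_mod_cast hn.ne'
  have hs : ∑ i, D.lossRate i = n * D.meanLoss := by rw [meanLoss]; field_simp
  have hr : ∑ i, ∑ k, D.R i k ^ 2 = n * (D.b + (1 - D.meanLoss) ^ 2) := by
    rw [← D.sum_sum_R_sq_div hn]; field_simp
  have h12 : ∀ i, ∫ ω, D.rho (D.treat fun k => t k ω) i * D.treat (fun k => t k ω) i ∂P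
      = (1 + (1 - D.lossRate i)) / 4 := fun i => by
    simp_rw [mul_comm (D.rho _ _)]
    exact D.integral_treat_mul_rho ht hti hb (hd i)
  have e12 : ∑ i, (1 + (1 - D.lossRate i)) / 4 = n * ((1 + (1 - D.meanLoss)) / 4) := by
    rw [← Finset.sum_div, Finset.sum_add_distrib, Finset.sum_sub_distrib, hs]
    simp
    ring
  have e22 : ∑ i, (1 + ∑ k, D.R i k ^ 2) / 4
      = n * ((1 + (D.b + (1 - D.meanLoss) ^ 2)) / 4) := by
    rw [← Finset.sum_div, Finset.sum_add_distrib, hr]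
    simp
    ring
  fin_cases a <;> fin_cases b <;> simp [designMatrix, meanGram]
  · simp_rw [fun i => D.integral_treat ht hb i]; simp
  · simp_rw [fun i => D.integral_rho ht hb (hd i)]; simp
  · simp_rw [fun i => D.integral_treat ht hb i]; simp
  · simp_rw [fun i => D.integral_treat_mul_treat ht hti hb i]; simp
  · simp_rw [fun i => D.integral_treat_mul_rho ht hti hb (hd i)]; exact e12
  · simp_rw [fun i => D.integral_rho ht hb (hd i)]; simp
  · simp_rw [h12]; exact e12
  · simp_rw [fun i => D.integral_rho_mul_rho ht hti hb (hd i)]; exact e22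

end EgoDesign

end

/-! ### Bounds at a fixed sample size -/

noncomputable section

/-- The assumptions on treatments and errors at a fixed sample size. -/
structure EgoDesign.IsExperiment {n : ℕ} (D : EgoDesign n) {Ω : Type*} [MeasurableSpace Ω]
    (P : Measure Ω) (t : Fin D.K → Ω → Bool) (ε : Fin n → Ω → ℝ) : Prop where
  measurable_treatment : ∀ k, Measurable (t k)
  indep_treatment : iIndepFun t P
  bernoulli : ∀ k, P {ω | t k ω = true} = 1 / 2
  measurable_error : ∀ i, Measurable (ε i)
  local_dependence : ∀ I J : Finset (Fin n), (∀ i ∈ I, ∀ j ∈ J, j ∉ D.ball i 2) →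
    IndepFun (fun ω (i : I) => ε i ω) (fun ω (j : J) => ε j ω) P
  indep_treat : IndepFun (fun ω i => ε i ω) (fun ω => D.treat fun k => t k ω) P
  memLp_two : ∀ i, MemLp (ε i) 2 P
  mean_zero : ∀ i, ∫ ω, ε i ω ∂P = 0

namespace EgoDesign.IsExperiment

variable {n : ℕ} {D : EgoDesign n} {Ω : Type*} [MeasurableSpace Ω] {P : Measure Ω}
  {t : Fin D.K → Ω → Bool} {ε : Fin n → Ω → ℝ}

/-- Functions of the treatments are independent of functions of the errors. -/
theorem indepFun_treatment_error (h : D.IsExperiment P t ε) (f : (Fin D.K → Bool) → ℝ)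
    {g : (Fin n → ℝ) → ℝ} (hg : Measurable g) :
    IndepFun (fun ω => f fun k => t k ω) (fun ω => g fun i => ε i ω) P :=
  ((D.indepFun_error_treatment h.indep_treat).comp hg (measurable_of_finite f)).symm

theorem integral_treatment_mul_error (h : D.IsExperiment P t ε) (f : (Fin D.K → Bool) → ℝ)
    {g : (Fin n → ℝ) → ℝ} (hg : Measurable g) :
    ∫ ω, (f fun k => t k ω) * (g fun i => ε i ω) ∂P
      = (∫ ω, (f fun k => t k ω) ∂P) * ∫ ω, (g fun i => ε i ω) ∂P := by
  have := h.measurable_error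
  exact (h.indepFun_treatment_error f hg).integral_fun_mul_eq_mul_integral
    (D.measurable_comp_treatment h.measurable_treatment f).aestronglyMeasurable
    (hg.comp (measurable_pi_lambda _ this)).aestronglyMeasurable

theorem isDependencyMatrix_weight_mul_error [IsProbabilityMeasure P] (h : D.IsExperiment P t ε)
    (V : Fin n → (Fin D.K → Bool) → ℝ)
    (hV : ∀ i a a', (∀ k ∈ D.reach i, a k = a' k) → V i a = V i a') :
    IsDependencyMatrix P (fun i j => D.Lam i j) (fun i ω => V i (fun k => t k ω) * ε i ω) :=
  D.isDependencyMatrix_Lam h.measurable_treatment h.indep_treatment h.measurable_error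
    h.local_dependence h.indep_treat (fun i a x => V i a * x) (fun i a => by fun_prop)
    (fun i a a' haa => by rw [hV i a a' haa])

theorem isDependencyMatrix_weight [IsProbabilityMeasure P] (h : D.IsExperiment P t ε)
    (V : Fin n → (Fin D.K → Bool) → ℝ)
    (hV : ∀ i a a', (∀ k ∈ D.reach i, a k = a' k) → V i a = V i a') :
    IsDependencyMatrix P (fun i j => D.Lam i j) (fun i ω => V i (fun k => t k ω)) :=
  D.isDependencyMatrix_Lam h.measurable_treatment h.indep_treatment h.measurable_error
    h.local_dependence h.indep_treat (fun i a _ => V i a) (fun i a => by fun_prop)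
    (fun i a a' haa => by rw [hV i a a' haa])

theorem memLp_weight_mul_error (h : D.IsExperiment P t ε) {f : (Fin D.K → Bool) → ℝ} {w : ℝ}
    (hf : ∀ a, |f a| ≤ w) (i : Fin n) : MemLp (fun ω => (f fun k => t k ω) * ε i ω) 2 P := by
  refine ((h.memLp_two i).const_mul w).mono (((D.measurable_comp_treatment
    h.measurable_treatment f).mul (h.measurable_error i)).aestronglyMeasurable)
    (Eventually.of_forall fun ω => ?_)
  rw [norm_mul, norm_mul]
  exact mul_le_mul_of_nonneg_right ((hf _).trans (le_abs_self w)) (norm_nonneg _)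

theorem integral_weight_mul_error (h : D.IsExperiment P t ε) (f : (Fin D.K → Bool) → ℝ)
    (i : Fin n) : ∫ ω, (f fun k => t k ω) * ε i ω ∂P = 0 := by
  rw [h.integral_treatment_mul_error f (g := fun x => x i) (by fun_prop), h.mean_zero, mul_zero]

theorem integral_error_sq (h : D.IsExperiment P t ε) (i : Fin n) :
    ∫ ω, ε i ω ^ 2 ∂P = variance (ε i) P :=
  (variance_of_integral_eq_zero (h.measurable_error i).aemeasurable (h.mean_zero i)).symm

theorem integral_error_mul_error [IsProbabilityMeasure P] (h : D.IsExperiment P t ε) (i j : Fin n) :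
    ∫ ω, ε i ω * ε j ω ∂P = covariance (ε i) (ε j) P := by
  rw [covariance_eq_sub (h.memLp_two i) (h.memLp_two j), h.mean_zero]
  simp

theorem covariance_eq_zero (h : D.IsExperiment P t ε) {i j : Fin n} (hij : j ∉ D.ball i 2) :
    covariance (ε i) (ε j) P = 0 := by
  have hind : IndepFun (ε i) (ε j) P :=
    (h.local_dependence {i} {j} (by simpa using hij)).comp
      (φ := fun f : ({i} : Finset (Fin n)) → ℝ => f ⟨i, by simp⟩)
      (ψ := fun f : ({j} : Finset (Fin n)) → ℝ => f ⟨j, by simp⟩) (by fun_prop) (by fun_prop)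
  exact hind.covariance_eq_zero (h.memLp_two i) (h.memLp_two j)

/-- Each product of two regressors is bounded by `1` and depends only on the clusters in `D.reach
i`, so the variance of the average is at most the number of dependent pairs over `n²`. -/
theorem integral_gram_sub_sq_le [IsProbabilityMeasure P] (h : D.IsExperiment P t ε) (hn : 0 < n)
    (hd : ∀ i, 0 < D.deg i) (a b : Fin 3) :
    ∫ ω, (D.gram (D.treat fun k => t k ω) a b - D.meanGram a b) ^ 2 ∂P
      ≤ (∑ i, ∑ j, D.Lam i j) / n ^ 2 := by
  have hn' : (n : ℝ) ≠ 0 := by exact_mod_cast hn.ne'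
  have hn0 : (0 : ℝ) < n := by exact_mod_cast hn
  set V : Fin n → (Fin D.K → Bool) → ℝ := fun i x =>
    D.designMatrix (D.treat x) i a * D.designMatrix (D.treat x) i b with hVdef
  have hV1 : ∀ i x, |V i x| ≤ 1 := fun i x => by
    simp only [hVdef]
    rw [abs_mul]
    exact mul_le_one₀ (D.abs_designMatrix_le x i a) (abs_nonneg _) (D.abs_designMatrix_le x i b)
  have hVm : ∀ i, Measurable fun ω => V i fun k => t k ω := fun i =>
    D.measurable_comp_treatment h.measurable_treatment (V i)
  have hdep := h.isDependencyMatrix_weight V fun i x x' hx => by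
    simp only [hVdef, D.designMatrix_congr hx]
  have key := hdep.integral_sum_sub_sq_le
    (fun i => MemLp.of_bound (hVm i).aestronglyMeasurable 1 (Eventually.of_forall fun ω => hV1 i _))
    (fun i => ∫ ω, V i (fun k => t k ω) ∂P) (fun i => rfl) (C := 1) (fun i => by
      calc ∫ ω, V i (fun k => t k ω) ^ 2 ∂P ≤ ∫ _, (1 : ℝ) ∂P :=
            integral_mono (D.integrable_comp_treatment h.measurable_treatment fun x => V i x ^ 2)
              (integrable_const _) fun ω => (sq_le_one_iff_abs_le_one _).2 (hV1 i _)
        _ = 1 := by simp)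
  rw [D.sum_integral_designMatrix hn hd h.measurable_treatment h.indep_treatment h.bernoulli,
    one_mul] at key
  have hrew : ∀ ω, (D.gram (D.treat fun k => t k ω) a b - D.meanGram a b) ^ 2
      = ((n : ℝ) ^ 2)⁻¹ * (∑ i, V i (fun k => t k ω) - n * D.meanGram a b) ^ 2 := fun ω => by
    simp only [gram, Matrix.of_apply, hVdef]
    field_simp
  simp_rw [hrew]
  rw [integral_const_mul, div_eq_inv_mul]
  gcongr

theorem integral_score_sq_le [IsProbabilityMeasure P] (h : D.IsExperiment P t ε) {M : ℝ}
    (hM : ∀ i, variance (ε i) P ≤ M) (a : Fin 3) :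
    ∫ ω, D.score (D.treat fun k => t k ω) (fun i => ε i ω) a ^ 2 ∂P
      ≤ M * (∑ i, ∑ j, D.Lam i j) / n := by
  set V : Fin n → (Fin D.K → Bool) → ℝ := fun i x => D.designMatrix (D.treat x) i a with hVdef
  have hV1 : ∀ i x, |V i x| ≤ 1 := fun i x => D.abs_designMatrix_le x i a
  have hdep := h.isDependencyMatrix_weight_mul_error V fun i x x' hx => by
    simp only [hVdef, D.designMatrix_congr hx]
  have hmem := fun i => h.memLp_weight_mul_error (hV1 i) i
  have key := hdep.integral_sum_sub_sq_le hmem (fun _ => 0)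
    (fun i => h.integral_weight_mul_error (V i) i) (C := M) (fun i => by
      refine le_trans ?_ (hM i)
      rw [← h.integral_error_sq]
      refine integral_mono (hmem i).integrable_sq (h.memLp_two i).integrable_sq fun ω => ?_
      simp only
      rw [mul_pow]
      exact mul_le_of_le_one_left (sq_nonneg _) ((sq_le_one_iff_abs_le_one _).2 (hV1 i _)))
  simp only [Finset.sum_const_zero, sub_zero] at key
  simp_rw [score, div_pow, Real.sq_sqrt (Nat.cast_nonneg n)]
  rw [integral_div]
  gcongr

theorem integrable_score_sq [IsProbabilityMeasure P] (h : D.IsExperiment P t ε) (a : Fin 3) :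
    Integrable (fun ω => D.score (D.treat fun k => t k ω) (fun i => ε i ω) a ^ 2) P := by
  refine MemLp.integrable_sq ?_
  simp only [score, div_eq_inv_mul]
  exact (memLp_finsetSum _ fun i _ => h.memLp_weight_mul_error
    (f := fun x => D.designMatrix (D.treat x) i a)
    (fun x => D.abs_designMatrix_le x i a) i).const_mul _

theorem integrable_gram_sub_sq [IsProbabilityMeasure P] (h : D.IsExperiment P t ε) (a b : Fin 3) :
    Integrable (fun ω => (D.gram (D.treat fun k => t k ω) a b - D.meanGram a b) ^ 2) P :=
  D.integrable_comp_treatment h.measurable_treatment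
    fun x => (D.gram (D.treat x) a b - D.meanGram a b) ^ 2

theorem integrable_olsError [IsProbabilityMeasure P] (h : D.IsExperiment P t ε) :
    Integrable (fun ω => D.olsError (D.treat fun k => t k ω) fun i => ε i ω) P :=
  ((integrable_finsetSum _ fun a _ => integrable_finsetSum _ fun b _ =>
    h.integrable_gram_sub_sq a b).const_mul _).add
    ((integrable_finsetSum _ fun a _ => h.integrable_score_sq a).div_const _)

/-- With `S` dependent pairs, the nine Gram entries have mean square error at most `S / n²` and the
three scores at most `M S / n`; the weights `√n` and `1 / √n` bring both to the order `S / n^(3/2)`.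
-/
theorem integral_olsError_le [IsProbabilityMeasure P] (h : D.IsExperiment P t ε) (hn : 0 < n) (hd : ∀ i, 0 < D.deg i)
    {M : ℝ} (hM : ∀ i, variance (ε i) P ≤ M) :
    ∫ ω, D.olsError (D.treat fun k => t k ω) (fun i => ε i ω) ∂P
      ≤ (9 + 3 * M) * ((∑ i, ∑ j, D.Lam i j) / n / Real.sqrt n) := by
  have hn0 : (0 : ℝ) < n := by exact_mod_cast hn
  have hs0 : 0 < Real.sqrt n := Real.sqrt_pos.2 hn0
  simp only [olsError]
  rw [integral_add ((integrable_finsetSum _ fun a _ => integrable_finsetSum _ fun b _ =>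
    h.integrable_gram_sub_sq a b).const_mul _)
    ((integrable_finsetSum _ fun a _ => h.integrable_score_sq a).div_const _),
    integral_const_mul, integral_div,
    integral_finsetSum _ fun a _ => integrable_finsetSum _ fun b _ => h.integrable_gram_sub_sq a b,
    integral_finsetSum _ fun a _ => h.integrable_score_sq a]
  simp_rw [integral_finsetSum _ fun b _ => h.integrable_gram_sub_sq _ b]
  set S := ∑ i, ∑ j, D.Lam i j with hS
  have e1 : ∑ a, ∑ b, ∫ ω, (D.gram (D.treat fun k => t k ω) a b - D.meanGram a b) ^ 2 ∂P
      ≤ 9 * (S / n ^ 2) := by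
    calc _ ≤ ∑ _a : Fin 3, ∑ _b : Fin 3, S / n ^ 2 :=
          Finset.sum_le_sum fun a _ => Finset.sum_le_sum fun b _ =>
            h.integral_gram_sub_sq_le hn hd a b
      _ = _ := by simp; ring
  have e2 : ∑ a, ∫ ω, D.score (D.treat fun k => t k ω) (fun i => ε i ω) a ^ 2 ∂P
      ≤ 3 * (M * S / n) := by
    calc _ ≤ ∑ _a : Fin 3, M * S / n := Finset.sum_le_sum fun a _ => h.integral_score_sq_le hM a
      _ = _ := by simp
  have e3 : Real.sqrt n * (9 * (S / n ^ 2)) = 9 * (S / n / Real.sqrt n) := by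
    have : (n : ℝ) = Real.sqrt n * Real.sqrt n := (Real.mul_self_sqrt hn0.le).symm
    have h2 : (n : ℝ) ^ 2 = n * (Real.sqrt n * Real.sqrt n) := by rw [← this]; ring
    rw [h2]
    field_simp
  calc _ ≤ Real.sqrt n * (9 * (S / n ^ 2)) + 3 * (M * S / n) / Real.sqrt n := by gcongr
    _ = _ := by rw [e3]; ring

/-- The asymptotic variance is the variance of the leading term. -/
theorem asympVar_eq [IsProbabilityMeasure P] (h : D.IsExperiment P t ε) (hn : 0 < n)
    (W : (Fin n → ℝ) → Fin n → ℝ) :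
    n * D.asympVar P t ε W = ∑ i, ∑ j, D.Lam i j *
      ∫ ω, (W (D.treat fun k => t k ω) i * ε i ω) * (W (D.treat fun k => t k ω) j * ε j ω) ∂P := by
  have hn' : (n : ℝ) ≠ 0 := by exact_mod_cast hn.ne'
  have h1 : ∀ i j, ∫ ω, (W (D.treat fun k => t k ω) i * ε i ω) *
      (W (D.treat fun k => t k ω) j * ε j ω) ∂P
      = (∫ ω, W (D.treat fun k => t k ω) i * W (D.treat fun k => t k ω) j ∂P)
        * covariance (ε i) (ε j) P := fun i j => by
    rw [← h.integral_error_mul_error, ← h.integral_treatment_mul_error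
      (fun x => W (D.treat x) i * W (D.treat x) j) (g := fun x => x i * x j) (by fun_prop)]
    congr 1
    ext ω
    ring
  simp_rw [h1]
  -- Outside `D.ball i 2` the error covariance vanishes and inside it `Λ = 1`, so the sum weighted
  -- by `Λ` reduces to the ball.
  have h2 : ∀ i, ∑ j, D.Lam i j * ((∫ ω, W (D.treat fun k => t k ω) i *
        W (D.treat fun k => t k ω) j ∂P) * covariance (ε i) (ε j) P)
      = (∫ ω, W (D.treat fun k => t k ω) i ^ 2 ∂P) * variance (ε i) P
        + ∑ j ∈ (D.ball i 2).erase i, (∫ ω, W (D.treat fun k => t k ω) i *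
          W (D.treat fun k => t k ω) j ∂P) * covariance (ε i) (ε j) P := fun i => by
    have hi : i ∈ D.ball i 2 := D.mem_ball.2 (by simp)
    have hvar : (∫ ω, W (D.treat fun k => t k ω) i ^ 2 ∂P) * variance (ε i) P
        = (∫ ω, W (D.treat fun k => t k ω) i * W (D.treat fun k => t k ω) i ∂P)
          * covariance (ε i) (ε i) P := by
      rw [covariance_self (h.measurable_error i).aemeasurable]
      simp_rw [sq]
    rw [hvar, Finset.add_sum_erase _ (fun j => (∫ ω, W (D.treat fun k => t k ω) i *
      W (D.treat fun k => t k ω) j ∂P) * covariance (ε i) (ε j) P) hi,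
      ← Finset.sum_subset (Finset.subset_univ (D.ball i 2))]
    · refine Finset.sum_congr rfl fun j hj => ?_
      rw [D.Lam_eq_one_of_mem_ball_two hj, one_mul]
    · intro j _ hj
      rw [h.covariance_eq_zero hj]
      simp
  simp_rw [h2]
  rw [Finset.sum_add_distrib, asympVar]
  field_simp

/-- The quantitative central limit theorem for the leading term. -/
theorem norm_integral_exp_leading_term_sub_le [IsProbabilityMeasure P] (h : D.IsExperiment P t ε) (hn : 0 < n)
    (W : (Fin n → ℝ) → Fin n → ℝ)
    (hWloc : ∀ i a a', (∀ k ∈ D.reach i, a k = a' k) → W (D.treat a) i = W (D.treat a') i)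
    {w M c : ℝ} (hW : ∀ a i, |W (D.treat a) i| ≤ w)
    (h4 : ∀ i, Integrable (fun ω => ε i ω ^ 4) P ∧ ∫ ω, ε i ω ^ 4 ∂P ≤ M) (hc : 0 < c)
    (hvar : c ≤ D.asympVar P t ε W) (s : ℝ) :
    ‖∫ ω, Complex.exp ((s * ((Real.sqrt (D.asympVar P t ε W))⁻¹ *
        ((∑ i, W (D.treat fun k => t k ω) i * ε i ω) / Real.sqrt n)) : ℝ) * Complex.I) ∂P
        - Complex.exp (-(s : ℂ) ^ 2 / 2)‖
      ≤ |s| * (|s| * (Real.sqrt (8 * max 1 (w ^ 4 * M) ^ 2 *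
          ((∑ i, ∑ j, (D.Lam ^ 3) i j) / n / n)) / c)
        + s ^ 2 * (3 * max 1 (w ^ 4 * M) / (c * Real.sqrt c) *
          ((∑ i, ((D.depSet i).card : ℝ) ^ 2) / n / Real.sqrt n))) := by
  have hn0 : (0 : ℝ) < n := by exact_mod_cast hn
  set C := max 1 (w ^ 4 * M) with hC
  set X : Fin n → Ω → ℝ := fun i ω => W (D.treat fun k => t k ω) i * ε i ω with hX
  set σ2 := D.asympVar P t ε W with hσ
  have hσ0 : 0 < σ2 := hc.trans_le hvar
  have hWm : ∀ i, Measurable fun ω => W (D.treat fun k => t k ω) i := fun i =>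
    D.measurable_comp_treatment h.measurable_treatment fun x => W (D.treat x) i
  have hXm : ∀ i, Measurable (X i) := fun i => (hWm i).mul (h.measurable_error i)
  have hdom : ∀ i ω, X i ω ^ 4 ≤ w ^ 4 * ε i ω ^ 4 := fun i ω => by
    simp only [hX, mul_pow]
    refine mul_le_mul_of_nonneg_right ?_ (by positivity)
    rw [← (show Even 4 by decide).pow_abs]
    exact pow_le_pow_left₀ (abs_nonneg _) (hW _ i) 4
  have hX4 : ∀ i, Integrable (fun ω => X i ω ^ 4) P := fun i =>
    ((h4 i).1.const_mul (w ^ 4)).mono' (by fun_prop) (Eventually.of_forall fun ω => by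
      rw [Real.norm_of_nonneg (by positivity)]
      exact hdom i ω)
  have hXC : ∀ i, ∫ ω, X i ω ^ 4 ∂P ≤ C := fun i => by
    refine le_trans ?_ (le_max_right _ _)
    calc ∫ ω, X i ω ^ 4 ∂P ≤ ∫ ω, w ^ 4 * ε i ω ^ 4 ∂P :=
          integral_mono (hX4 i) ((h4 i).1.const_mul _) (hdom i)
      _ ≤ w ^ 4 * M := by
          rw [integral_const_mul]
          exact mul_le_mul_of_nonneg_left (h4 i).2 (by positivity)
  have hdep := h.isDependencyMatrix_weight_mul_error (fun i a => W (D.treat a) i) hWloc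
  have key := hdep.norm_integral_exp_sub_le hXm hX4 (le_max_left _ _) hXC
    (fun i => h.integral_weight_mul_error (fun a => W (D.treat a) i) i)
    (h.asympVar_eq hn W) (by positivity) s
  have hrew : ∀ ω, (Real.sqrt (n * σ2))⁻¹ * ∑ i, W (D.treat fun k => t k ω) i * ε i ω
      = (Real.sqrt σ2)⁻¹ * ((∑ i, W (D.treat fun k => t k ω) i * ε i ω) / Real.sqrt n) :=
      fun ω => by
    rw [Real.sqrt_mul hn0.le, mul_inv]
    ring
  rw [← hσ, show (Matrix.of fun i j => D.Lam i j) = D.Lam from rfl] at key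
  simp_rw [← hrew]
  refine key.trans ?_
  have hcn : n * c ≤ n * σ2 := by gcongr
  have hW3 : 0 ≤ ∑ i, ∑ j, (D.Lam ^ 3) i j := by
    rw [Matrix.sum_pow_three_apply]
    have := hdep.nonneg
    exact Finset.sum_nonneg fun i _ => Finset.sum_nonneg fun j _ => Finset.sum_nonneg fun k _ =>
      Finset.sum_nonneg fun l _ => mul_nonneg (mul_nonneg (this _ _) (this _ _)) (this _ _)
  have hC0 : 0 < C := lt_of_lt_of_le one_pos (le_max_left _ _)
  have e1 : Real.sqrt (8 * C ^ 2 * ∑ i, ∑ j, (D.Lam ^ 3) i j) / (n * σ2)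
      ≤ Real.sqrt (8 * C ^ 2 * ((∑ i, ∑ j, (D.Lam ^ 3) i j) / n / n)) / c := by
    have : 8 * C ^ 2 * ((∑ i, ∑ j, (D.Lam ^ 3) i j) / n / n)
        = (8 * C ^ 2 * ∑ i, ∑ j, (D.Lam ^ 3) i j) / (n : ℝ) ^ 2 := by
      field_simp
    rw [this, Real.sqrt_div' _ (by positivity), Real.sqrt_sq hn0.le, div_div]
    gcongr
  have e2 : 3 * (C * ∑ i, (∑ j, D.Lam i j) ^ 2) / (n * σ2 * Real.sqrt (n * σ2))
      ≤ 3 * C / (c * Real.sqrt c) * ((∑ i, ((D.depSet i).card : ℝ) ^ 2) / n / Real.sqrt n) := by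
    simp_rw [card_depSet]
    calc 3 * (C * ∑ i, (∑ j, D.Lam i j) ^ 2) / (n * σ2 * Real.sqrt (n * σ2))
        ≤ 3 * (C * ∑ i, (∑ j, D.Lam i j) ^ 2) / (n * c * Real.sqrt (n * c)) := by
          gcongr
      _ = _ := by
          rw [Real.sqrt_mul hn0.le]
          field_simp
  gcongr

/-- The treatments take finitely many values, so every coefficient built from them is measurable,
whatever the inverse means for a singular matrix; the errors enter linearly. -/
theorem measurable_ols (h : D.IsExperiment P t ε) (α β γ : ℝ) (a : Fin 3) :
    Measurable fun ω => D.ols (D.treat fun k => t k ω)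
      (D.outcome α β γ (D.treat fun k => t k ω) fun i => ε i ω) a := by
  simp only [ols, Matrix.mulVec, dotProduct, outcome]
  refine Finset.measurable_fun_sum _ fun i _ => Measurable.mul ?_ (Measurable.add ?_ ?_)
  · exact D.measurable_comp_treatment h.measurable_treatment fun x =>
      (((D.designMatrix (D.treat x)).transpose * D.designMatrix (D.treat x))⁻¹ *
        (D.designMatrix (D.treat x)).transpose) a i
  · exact D.measurable_comp_treatment h.measurable_treatment fun x =>
      α + β * D.treat x i + γ * D.rho (D.treat x) i
  · exact h.measurable_error i

end EgoDesign.IsExperiment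

end

/-! ### From characteristic functions to convergence in distribution -/

section Limits

variable {Ω : ℕ → Type*} [∀ n, MeasurableSpace (Ω n)] {P : (n : ℕ) → Measure (Ω n)}
  [∀ n, IsProbabilityMeasure (P n)] {U V Z : (n : ℕ) → Ω n → ℝ}

/-- Where `|U - V| < η` the integrands differ by at most `|s| η`, because `x ↦ exp(ix)` is
1-Lipschitz; elsewhere by at most `2`. -/
theorem norm_integral_exp_sub_integral_exp_le {Ω : Type*} [MeasurableSpace Ω] {P : Measure Ω}
    [IsProbabilityMeasure P] {U V : Ω → ℝ} (hU : Measurable U) (hV : Measurable V) (s : ℝ) {η : ℝ}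
    (hη : 0 < η) :
    ‖∫ ω, Complex.exp ((s * U ω : ℝ) * Complex.I) ∂P
        - ∫ ω, Complex.exp ((s * V ω : ℝ) * Complex.I) ∂P‖
      ≤ |s| * η + 2 * P.real {ω | η ≤ |U ω - V ω|} := by
  have hi : ∀ {f : Ω → ℝ}, Measurable f →
      Integrable (fun ω => Complex.exp ((s * f ω : ℝ) * Complex.I)) P := fun hf =>
    Integrable.of_bound (by fun_prop) 1
      (Eventually.of_forall fun ω => (Complex.norm_exp_ofReal_mul_I _).le)
  have hs : MeasurableSet {ω | η ≤ |U ω - V ω|} :=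
    measurableSet_le measurable_const (hU.sub hV).abs
  have hind : Integrable (Set.indicator {ω | η ≤ |U ω - V ω|} (1 : Ω → ℝ)) P :=
    (integrable_const (1 : ℝ)).indicator hs
  rw [← integral_sub (hi hU) (hi hV)]
  refine (norm_integral_le_of_norm_le (g := fun ω => |s| * η + 2 *
    Set.indicator {ω | η ≤ |U ω - V ω|} (1 : Ω → ℝ) ω)
    ((integrable_const _).add (hind.const_mul 2)) (Eventually.of_forall fun ω => ?_)).trans_eq ?_
  · by_cases h : η ≤ |U ω - V ω|
    · have h2 : Set.indicator {ω | η ≤ |U ω - V ω|} (1 : Ω → ℝ) ω = 1 :=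
        Set.indicator_of_mem (s := {ω | η ≤ |U ω - V ω|}) h _
      rw [h2]
      refine (norm_sub_le _ _).trans ?_
      rw [Complex.norm_exp_ofReal_mul_I, Complex.norm_exp_ofReal_mul_I]
      have : 0 ≤ |s| * η := by positivity
      linarith
    · have h2 : Set.indicator {ω | η ≤ |U ω - V ω|} (1 : Ω → ℝ) ω = 0 :=
        Set.indicator_of_notMem (s := {ω | η ≤ |U ω - V ω|}) h _
      rw [h2, mul_zero, add_zero]
      have e : Complex.exp ((s * U ω : ℝ) * Complex.I) - Complex.exp ((s * V ω : ℝ) * Complex.I)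
          = Complex.exp ((s * V ω : ℝ) * Complex.I) *
            (Complex.exp (Complex.I * (s * (U ω - V ω) : ℝ)) - 1) := by
        rw [mul_sub, ← Complex.exp_add]
        push_cast
        ring_nf
      rw [e, norm_mul, Complex.norm_exp_ofReal_mul_I, one_mul]
      refine Real.norm_exp_I_mul_ofReal_sub_one_le.trans ?_
      rw [Real.norm_eq_abs, abs_mul]
      gcongr
      exact (not_le.1 h).le
  · rw [integral_add (integrable_const _) (hind.const_mul 2), integral_const_mul (2 : ℝ),
      integral_indicator_one hs]
    simp

/-- Convergence in distribution to the standard normal law from convergence of characteristic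
functions, up to a remainder that vanishes in probability. -/
theorem tendstoInDistribution_gaussian_of_tendsto_integral_exp (hU : ∀ n, Measurable (U n))
    (hV : ∀ n, Measurable (V n))
    (hchar : ∀ s : ℝ, Tendsto (fun n => ∫ ω, Complex.exp ((s * V n ω : ℝ) * Complex.I) ∂(P n))
      atTop (nhds (Complex.exp (-(s : ℂ) ^ 2 / 2))))
    (hUV : ∀ η : ℝ, 0 < η →
      Tendsto (fun n => (P n).real {ω | η ≤ |U n ω - V n ω|}) atTop (nhds 0)) :
    TendstoInDistribution U atTop (id : ℝ → ℝ) P (gaussianReal 0 1) where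
  forall_aemeasurable n := (hU n).aemeasurable
  tendsto := by
    refine ProbabilityMeasure.tendsto_iff_tendsto_charFun.2 fun s => ?_
    have e1 : ∀ n, charFun ((P n).map (U n)) s
        = ∫ ω, Complex.exp ((s * U n ω : ℝ) * Complex.I) ∂(P n) := fun n => by
      rw [charFun_apply_real, integral_map (hU n).aemeasurable (by fun_prop)]
      push_cast
      rfl
    have e2 : charFun ((gaussianReal 0 1).map id) s = Complex.exp (-(s : ℂ) ^ 2 / 2) := by
      rw [Measure.map_id, charFun_gaussianReal]
      congr 1
      push_cast
      ring
    simp only [ProbabilityMeasure.coe_mk, e1, e2]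
    have hdiff : Tendsto (fun n => ∫ ω, Complex.exp ((s * U n ω : ℝ) * Complex.I) ∂(P n)
        - ∫ ω, Complex.exp ((s * V n ω : ℝ) * Complex.I) ∂(P n)) atTop (nhds 0) := by
      rw [Metric.tendsto_atTop']
      intro δ hδ
      set η := δ / (2 * (|s| + 1)) with hη
      have hs : 0 < |s| + 1 := by positivity
      have hη0 : 0 < η := by positivity
      obtain ⟨N, hN⟩ := ((hUV η hη0).eventually (gt_mem_nhds (by positivity : (0 : ℝ) < δ / 4))
        ).exists_forall_of_atTop
      refine ⟨N, fun n hn => ?_⟩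
      rw [dist_zero_right]
      refine (norm_integral_exp_sub_integral_exp_le (hU n) (hV n) s hη0).trans_lt ?_
      have h1 := hN n hn.le
      have h2 : |s| * η ≤ δ / 2 := by
        calc |s| * η ≤ (|s| + 1) * η := by gcongr; linarith
          _ = δ / 2 := by rw [hη]; field_simp
      linarith
    simpa using hdiff.add (hchar s)

/-- Markov's inequality for `Z`. The bound on `|U - V|` is needed only where `Z` is small, which
allows the linearisation to fail on an event of vanishing probability. -/
theorem tendsto_measureReal_le_abs_sub_of_le {z κ : ℝ} (hz : 0 < z) (hκ : 0 < κ)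
    (hZ0 : ∀ n ω, 0 ≤ Z n ω) (hZi : ∀ n, Integrable (Z n) (P n))
    (hZ : Tendsto (fun n => ∫ ω, Z n ω ∂(P n)) atTop (nhds 0))
    (hle : ∀ᶠ n in atTop, ∀ ω, Z n ω ≤ z → |U n ω - V n ω| ≤ κ * Z n ω) (η : ℝ) (hη : 0 < η) :
    Tendsto (fun n => (P n).real {ω | η ≤ |U n ω - V n ω|}) atTop (nhds 0) := by
  -- Below `δ` the bound applies and gives at most `η / 2`; the factor `2` makes the inequality
  -- against `η` strict.
  set δ := min z (η / (2 * κ)) with hδ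
  have hδ0 : 0 < δ := lt_min hz (by positivity)
  have hlim : Tendsto (fun n => (∫ ω, Z n ω ∂(P n)) / δ) atTop (nhds 0) := by
    simpa using hZ.div_const δ
  refine squeeze_zero' (Eventually.of_forall fun n => measureReal_nonneg) ?_ hlim
  filter_upwards [hle] with n hn
  have hsub : {ω | η ≤ |U n ω - V n ω|} ⊆ {ω | δ ≤ Z n ω} := fun ω hω => by
    by_contra hlt
    have hlt : Z n ω < δ := not_le.1 hlt
    have h1 := hn ω (hlt.le.trans (min_le_left _ _))
    have h2 : κ * Z n ω < η := by
      calc κ * Z n ω ≤ κ * (η / (2 * κ)) := by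
            gcongr
            exact hlt.le.trans (min_le_right _ _)
        _ = η / 2 := by field_simp
        _ < η := by linarith
    exact absurd (le_trans (show η ≤ |U n ω - V n ω| from hω) h1) (not_le.2 h2)
  rw [le_div_iff₀ hδ0, mul_comm]
  calc δ * (P n).real {ω | η ≤ |U n ω - V n ω|} ≤ δ * (P n).real {ω | δ ≤ Z n ω} := by
        gcongr
        exact measure_ne_top _ _
    _ ≤ _ := mul_meas_ge_le_integral_of_nonneg (Eventually.of_forall (hZ0 n)) (hZi n) δ

end Limits

/-! ### The limit as the sample size grows -/

noncomputable section

theorem EgoDesign.olsError_nonneg {n : ℕ} (D : EgoDesign n) (T ε : Fin n → ℝ) :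
    0 ≤ D.olsError T ε := by
  unfold EgoDesign.olsError
  positivity

theorem EgoDesign.sum_sum_Lam_le {n : ℕ} (D : EgoDesign n) :
    ∑ i, ∑ j, D.Lam i j ≤ ∑ i, ((D.depSet i).card : ℝ) ^ 2 :=
  Finset.sum_le_sum fun i _ => by
    rw [← D.card_depSet]
    exact_mod_cast Nat.le_self_pow two_ne_zero _

theorem CorrelatedErrors.isExperiment {D : (n : ℕ) → EgoDesign n} {Ω : ℕ → Type*}
    [∀ n, MeasurableSpace (Ω n)] {P : (n : ℕ) → Measure (Ω n)}
    {t : (n : ℕ) → Fin (D n).K → Ω n → Bool} {ε : (n : ℕ) → Fin n → Ω n → ℝ}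
    (herr : CorrelatedErrors D P t ε) (hdesign : EgoRandomization D P t) (n : ℕ) :
    (D n).IsExperiment (P n) (t n) (ε n) where
  measurable_treatment := hdesign.measurable n
  indep_treatment := hdesign.indep n
  bernoulli := hdesign.bernoulli n
  measurable_error := herr.measurable n
  local_dependence := herr.local_dependence n
  indep_treat := herr.indep_treat n
  memLp_two := herr.memLp_two n
  mean_zero := herr.mean_zero n

section Asymptotics

variable {D : (n : ℕ) → EgoDesign n} {Ω : ℕ → Type*} [∀ n, MeasurableSpace (Ω n)]
  {P : (n : ℕ) → Measure (Ω n)} [∀ n, IsProbabilityMeasure (P n)]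
  {t : (n : ℕ) → Fin (D n).K → Ω n → Bool} {ε : (n : ℕ) → Fin n → Ω n → ℝ}

theorem DependencyGrowth.tendsto_second (hdep : DependencyGrowth D) :
    Tendsto (fun n : ℕ => (∑ i, (((D n).depSet i).card : ℝ) ^ 2) / n / Real.sqrt n) atTop
      (nhds 0) :=
  hdep.second.tendsto_div_nhds_zero

theorem DependencyGrowth.tendsto_paths (hdep : DependencyGrowth D) :
    Tendsto (fun n : ℕ => (∑ i, ∑ j, ((D n).Lam ^ 3) i j) / n / n) atTop (nhds 0) :=
  hdep.paths.tendsto_div_nhds_zero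

theorem tendsto_integral_olsError (hdeg : ∀ᶠ n in atTop, ∀ i, 0 < (D n).deg i)
    (hdep : DependencyGrowth D) (hexp : ∀ n, (D n).IsExperiment (P n) (t n) (ε n))
    {M : ℝ} (hM : ∀ n i, variance (ε n i) (P n) ≤ M) :
    Tendsto (fun n => ∫ ω, (D n).olsError ((D n).treat fun k => t n k ω) (fun i => ε n i ω) ∂(P n))
      atTop (nhds 0) := by
  -- Taking `max M 0` keeps the coefficient nonnegative without a sign assumption on `M`.
  have hlim : Tendsto (fun n : ℕ => (9 + 3 * max M 0) *
      ((∑ i, (((D n).depSet i).card : ℝ) ^ 2) / n / Real.sqrt n)) atTop (nhds 0) := by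
    simpa using hdep.tendsto_second.const_mul (9 + 3 * max M 0)
  refine squeeze_zero' (Eventually.of_forall fun n => integral_nonneg fun ω =>
    (D n).olsError_nonneg _ _) ?_ hlim
  filter_upwards [hdeg, eventually_gt_atTop 0] with n hd hn
  refine ((hexp n).integral_olsError_le hn hd fun i => (hM n i).trans (le_max_left M 0)).trans ?_
  have := le_max_right M 0
  have := (D n).sum_sum_Lam_le
  gcongr

/-- Asymptotic normality of an estimator with leading term `∑ W i ε i / √n`. -/
theorem tendstoInDistribution_of_abs_sub_le_olsError
    (hdeg : ∀ᶠ n in atTop, ∀ i, 0 < (D n).deg i)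
    (hdep : DependencyGrowth D) (hexp : ∀ n, (D n).IsExperiment (P n) (t n) (ε n))
    {M M₄ : ℝ} (hM : ∀ n i, variance (ε n i) (P n) ≤ M)
    (h4 : ∀ n i, Integrable (fun ω => ε n i ω ^ 4) (P n) ∧ ∫ ω, ε n i ω ^ 4 ∂(P n) ≤ M₄)
    (W : (n : ℕ) → (Fin n → ℝ) → Fin n → ℝ)
    (hWloc : ∀ n i a a', (∀ k ∈ (D n).reach i, a k = a' k) →
      W n ((D n).treat a) i = W n ((D n).treat a') i)
    {w : ℝ} (hW : ∀ᶠ n in atTop, ∀ a i, |W n ((D n).treat a) i| ≤ w)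
    {c : ℝ} (hc : 0 < c) (hvar : ∀ᶠ n in atTop, c ≤ (D n).asympVar (P n) (t n) (ε n) (W n))
    {E : (n : ℕ) → Ω n → ℝ} (hE : ∀ n, Measurable (E n)) {z κ : ℝ} (hz : 0 < z) (hκ : 0 < κ)
    (hle : ∀ᶠ n in atTop, ∀ ω,
      (D n).olsError ((D n).treat fun k => t n k ω) (fun i => ε n i ω) ≤ z →
      |E n ω - (∑ i, W n ((D n).treat fun k => t n k ω) i * ε n i ω) / Real.sqrt n|
        ≤ κ * (D n).olsError ((D n).treat fun k => t n k ω) (fun i => ε n i ω)) :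
    TendstoInDistribution (fun (n : ℕ) (ω : Ω n) =>
        (Real.sqrt ((D n).asympVar (P n) (t n) (ε n) (W n)))⁻¹ * E n ω)
      atTop (id : ℝ → ℝ) P (gaussianReal 0 1) := by
  have hsc : 0 < Real.sqrt c := Real.sqrt_pos.2 hc
  refine tendstoInDistribution_gaussian_of_tendsto_integral_exp
    (V := fun n ω => (Real.sqrt ((D n).asympVar (P n) (t n) (ε n) (W n)))⁻¹ *
      ((∑ i, W n ((D n).treat fun k => t n k ω) i * ε n i ω) / Real.sqrt n))
    (fun n => (hE n).const_mul _) (fun n => ?_) (fun s => ?_)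
    (tendsto_measureReal_le_abs_sub_of_le (Z := fun n ω =>
      (D n).olsError ((D n).treat fun k => t n k ω) (fun i => ε n i ω)) (κ := (Real.sqrt c)⁻¹ * κ)
      hz (by positivity) (fun n ω => (D n).olsError_nonneg _ _)
      (fun n => (hexp n).integrable_olsError) (tendsto_integral_olsError hdeg hdep hexp hM) ?_)
  · refine ((Finset.measurable_fun_sum _ fun i _ => Measurable.mul ?_
      ((hexp n).measurable_error i)).div_const _).const_mul _
    exact (D n).measurable_comp_treatment (hexp n).measurable_treatment
      fun x => W n ((D n).treat x) i
  · rw [tendsto_iff_norm_sub_tendsto_zero]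
    have h1 : Tendsto (fun n : ℕ => Real.sqrt (8 * max 1 (w ^ 4 * M₄) ^ 2 *
        ((∑ i, ∑ j, ((D n).Lam ^ 3) i j) / n / n)) / c) atTop (nhds 0) := by
      have h := ((hdep.tendsto_paths.const_mul (8 * max 1 (w ^ 4 * M₄) ^ 2)).sqrt).div_const c
      simpa only [mul_zero, Real.sqrt_zero, zero_div] using h
    have h2 := hdep.tendsto_second.const_mul (3 * max 1 (w ^ 4 * M₄) / (c * Real.sqrt c))
    have hlim := (((h1.const_mul |s|).add (h2.const_mul (s ^ 2))).const_mul |s|)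
    simp only [mul_zero, add_zero] at hlim
    refine squeeze_zero' (Eventually.of_forall fun n => norm_nonneg _) ?_ hlim
    filter_upwards [hW, hvar, eventually_gt_atTop 0] with n hWn hvn hn
    exact (hexp n).norm_integral_exp_leading_term_sub_le hn (W n) (hWloc n) hWn (h4 n) hc hvn s
  · filter_upwards [hvar, hle] with n hvn hn ω hω
    rw [← mul_sub, abs_mul, mul_assoc,
      abs_of_nonneg (inv_nonneg.2 (Real.sqrt_nonneg ((D n).asympVar (P n) (t n) (ε n) (W n))))]
    exact mul_le_mul (inv_anti₀ hsc (Real.sqrt_le_sqrt hvn)) (hn ω hω) (abs_nonneg _)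
      (by positivity)

end Asymptotics

theorem theorem5
    (D : (n : ℕ) → EgoDesign n)
    {Ω : ℕ → Type*} [∀ n, MeasurableSpace (Ω n)]
    (P : (n : ℕ) → Measure (Ω n)) [∀ n, IsProbabilityMeasure (P n)]
    (t : (n : ℕ) → Fin (D n).K → Ω n → Bool)
    (ε : (n : ℕ) → Fin n → Ω n → ℝ)
    (α β γ : ℝ)
    (hdeg : ∀ᶠ n in atTop, ∀ i, 0 < (D n).deg i)
    (hdesign : EgoRandomization D P t)
    (hnet : NetworkVariation D)
    (hdep : DependencyGrowth D)
    (herr : CorrelatedErrors D P t ε)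
    (hfourth : ∃ M : ℝ, ∀ n i, Integrable (fun ω => ε n i ω ^ 4) (P n) ∧
      ∫ ω, ε n i ω ^ 4 ∂(P n) ≤ M) :
    ((∃ c : ℝ, 0 < c ∧ ∀ᶠ n in atTop, c ≤ (D n).sigmaTauSq (P n) (t n) (ε n)) →
      TendstoInDistribution
        (fun (n : ℕ) (ω : Ω n) =>
          (Real.sqrt ((D n).sigmaTauSq (P n) (t n) (ε n)))⁻¹ * (Real.sqrt n *
            ((D n).tauHat ((D n).treat fun k => t n k ω)
              ((D n).outcome α β γ ((D n).treat fun k => t n k ω) (fun i => ε n i ω))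
              - (β + γ))))
        atTop (id : ℝ → ℝ) P (gaussianReal 0 1)) ∧
    ((∃ c : ℝ, 0 < c ∧ ∀ᶠ n in atTop, c ≤ (D n).sigmaGammaSq (P n) (t n) (ε n)) →
      TendstoInDistribution
        (fun (n : ℕ) (ω : Ω n) =>
          (Real.sqrt ((D n).sigmaGammaSq (P n) (t n) (ε n)))⁻¹ * (Real.sqrt n *
            ((D n).gammaHat ((D n).treat fun k => t n k ω)
              ((D n).outcome α β γ ((D n).treat fun k => t n k ω) (fun i => ε n i ω))
              - γ)))
        atTop (id : ℝ → ℝ) P (gaussianReal 0 1)) := by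
  have hexp := herr.isExperiment hdesign
  obtain ⟨M, hM⟩ := herr.variance_bdd
  obtain ⟨M₄, h4⟩ := hfourth
  obtain ⟨c₀, hc₀, hnet⟩ := hnet
  have hb : ∀ᶠ n in atTop, c₀ ≤ (D n).b := hnet.mono fun n hn => hn.le.trans (D n).max_le_b
  have hq : 0 < 4 + 4 / c₀ := by positivity
  have hQ : ∀ᶠ n in atTop, ∀ a b, |(D n).meanGramInv a b| ≤ 4 + 4 / c₀ := hb.mono fun n hn =>
    (D n).abs_meanGramInv_le hc₀ hn (D n).meanLoss_nonneg (D n).meanLoss_le_one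
  have hz : 0 < (1 / (18 * (4 + 4 / c₀))) ^ 2 := by positivity
  refine ⟨fun ⟨c, hc, hvar⟩ => ?_, fun ⟨c, hc, hvar⟩ => ?_⟩
  · refine tendstoInDistribution_of_abs_sub_le_olsError hdeg hdep hexp hM h4
      (fun n => (D n).Wtau) (fun n i a a' h => (D n).Wtau_congr h) (w := 4 + 4 / c₀)
      (hb.mono fun n hn => (D n).abs_Wtau_le hc₀ hn) hc hvar (fun n => ?_) hz
      -- `τ̂` is the sum of two coordinates, each with remainder constant `27`.
      (κ := 54 * (4 + 4 / c₀) ^ 2) (by positivity) ?_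
    · exact ((((hexp n).measurable_ols α β γ 1).add ((hexp n).measurable_ols α β γ 2)).sub_const
        _).const_mul _
    · filter_upwards [hb, hQ, eventually_gt_atTop 0] with n hbn hQn hn ω hω
      have key := (D n).abs_ols_sub_le hn α β γ _ _ hq (hc₀.trans_le hbn).ne' hQn hω
      have k1 := key 1
      have k2 := key 2
      rw [← (D n).meanGramInv_mulVec_score_one]
      refine le_trans (le_of_eq ?_) ((abs_add_le _ _).trans ((add_le_add k1 k2).trans_eq ?_))
      · congr 1
        simp [EgoDesign.tauHat]
        ring
      · ring
  · refine tendstoInDistribution_of_abs_sub_le_olsError hdeg hdep hexp hM h4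
      (fun n => (D n).Wgamma) (fun n i a a' h => (D n).Wgamma_congr h) (w := 4 / c₀)
      (hb.mono fun n hn => (D n).abs_Wgamma_le hc₀ hn) hc hvar (fun n => ?_) hz
      (κ := 27 * (4 + 4 / c₀) ^ 2) (by positivity) ?_
    · exact (((hexp n).measurable_ols α β γ 2).sub_const _).const_mul _
    · filter_upwards [hb, hQ, eventually_gt_atTop 0] with n hbn hQn hn ω hω
      rw [← (D n).meanGramInv_mulVec_score_two]
      exact (D n).abs_ols_sub_le hn α β γ _ _ hq (hc₀.trans_le hbn).ne' hQn hω 2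

end
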